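/- All graphs are finite, simple and undirected. A total-coloring of a graph $G$ assigns a color to every vertex and to every edge of $G$. A path is a total monochromatic path if all its edges and all its internal vertices have the same color. A total-coloring is a TMC-coloring if any two vertices of $G$ are connected by a total monochromatic path. For a connected graph $G$, $tmc(G)$ denotes the maximum number of colors used in a TMC-coloring of $G$. For positive integers $n$ and $k$ let $f(n,k)$ be the minimum integer $f\ge n-1$ such that every connected graph $G$ of order $n$ with $|E(G)|\ge f$ satisfies $tmc(G)\ge k$. (A connected graph of order $n$ has at least $n-1$ edges, so the condition $f\geq n-1$ only rules out vacuously small values.) Theorem. Let $n$ and $k$ be positive integers with $3\le k\le\binom n2+n$. Then $$f(n,k)=\begin{cases} n-1 & \text{if } k=3,\\ n+k-t-2 & \text{if } k=\binom t2+t+2-s \text{ for integers } 0\le s\le t-1,\ 2\le t\le n-2,\\ k & \text{if } \binom n2-n+4\le k\le \binom n2+n-3\lfloor\frac n2\rfloor,\text{ except when } n \text{ is odd and } k=\binom n2+n-3\lfloor\frac n2\rfloor,\\ \binom n2-r & \text{if } \binom n2+n-3(r+1)<k\le\binom n2+n-3r \text{ for an integer } 0\le r\le\lfloor\frac n2\rfloor-1,\\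 & \text{or if } n \text{ is odd},\ r=\lfloor\frac n2\rfloor \text{ and } k=\binom n2+n-3\lfloor\frac n2\rfloor. \end{cases}$$ The cases cover all such $n$ and $k$, and agree where they overlap. -/

import Mathlib

namespace SimpleGraph

/-- A total-coloring of `G`: every vertex and every edge receives a color (a natural number). -/
abbrev TotalColoring {V : Type*} (G : SimpleGraph V) : Type _ := V ⊕ G.edgeSet → ℕ

/-- A walk `p` from `u` to `v` is a total monochromatic path if it is a path and all its edges
and all its internal vertices (those different from the two ends) have one common color. -/
def TotalColoring.IsMonoPath {V : Type*} {G : SimpleGraph V} (col : G.TotalColoring) {u v : V}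
    (p : G.Walk u v) : Prop :=
  p.IsPath ∧ ∃ c : ℕ,
    (∀ e (he : e ∈ p.edges), col (Sum.inr ⟨e, p.edges_subset_edgeSet he⟩) = c) ∧
    (∀ w ∈ p.support, w ≠ u → w ≠ v → col (Sum.inl w) = c)

/-- A total-coloring is a TMC-coloring if any two vertices are joined by a total monochromatic
path. -/
def TotalColoring.IsTMC {V : Type*} {G : SimpleGraph V} (col : G.TotalColoring) : Prop :=
  ∀ u v : V, ∃ p : G.Walk u v, col.IsMonoPath p

/-- The number of colors that a total-coloring uses on the vertices and edges. -/
noncomputable def TotalColoring.numColors {V : Type*} {G : SimpleGraph V}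
    (col : G.TotalColoring) : ℕ :=
  (Set.range col).ncard

/-- The total monochromatic connection number: the maximum number of colors used in a
TMC-coloring. For a finite connected graph this is a maximum over a nonempty bounded set. -/
noncomputable def tmc {V : Type*} (G : SimpleGraph V) : ℕ :=
  sSup {N : ℕ | ∃ col : G.TotalColoring, col.IsTMC ∧ col.numColors = N}

/-- `m` is an edge bound forcing `tmc ≥ k` on `n` vertices: every connected graph of order `n`
with at least `m` edges has `tmc ≥ k`. -/
def ForcesTmc (n k m : ℕ) : Prop :=
  ∀ G : SimpleGraph (Fin n), G.Connected → m ≤ G.edgeSet.ncard → k ≤ G.tmc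

/-- The edge bounds `m` forcing `tmc ≥ k` on `n` vertices, among the integers `m ≥ n - 1`.
(A connected graph of order `n` has at least `n - 1` edges, so smaller bounds are all
equivalent to `n - 1`, and the least bound is sought among the others.) -/
def forcingBounds (n k : ℕ) : Set ℕ :=
  {m : ℕ | n ≤ m + 1 ∧ ForcesTmc n k m}

end SimpleGraph

/-! Write m for the number of edges of G. There are m + n objects to color, and a color class with w
+ 1 members wastes w of the m + n possible colors. The task is to find how little waste a
TMC-coloring can have.

Lower bounds on `tmc`. Give one color to the edges and inner vertices of a spanning tree and
pairwise different new colors to everything else: a tree with l leaves yields m - n + 2 + l colors.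
A connected set with l neighbors extends to such a tree with at least l leaves (`Grown.le_tmc`). By
the theorem of Ding, Johnson and Seymour (`two_mul_card_edgeFinset_le`), for T + 3 ≤ n and m ≥ n +
C(T,2) some connected set has more than T neighbors, so tmc ≥ m - n + T + 3. If at most r edges are
missing and 2r < n, some vertex is adjacent to all others; a star from it to the at most 2r ends of
missing edges replaces the spanning tree and gives tmc ≥ m + n - 2r (`card_add_card_le_tmc_add`).

Upper bounds on `tmc`. Each vertex with a non-neighbor costs one color (`tmc_add_card_le`), which
settles graphs whose missing edges cover many vertices. In a graph with a pendant path, all links to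
the far end share a color, and that class contains a spanning connected subgraph and the inner path
vertices (`tmc_add_le_of_pendant_path`). A long path whose inner vertices have degree two and whose
ends are nonadjacent forces the same loss (`IsTheta.tmc_add_le`), although the wasted members may be
spread over two classes.

In each range of k the lower bound gives tmc ≥ k from f edges on, and one of these graphs with f - 1
edges has tmc < k, unless f = n - 1 already. -/

namespace SimpleGraph

/-! ### Counting vertices by edges -/

section Counting

open scoped Classical

variable {V : Type*} [Fintype V]

/-- Vertices with a neighbour of smaller rank inject into the edges. -/
theorem card_le_card_edgeFinset_of_rank (F : SimpleGraph V) (S : Finset V) (rank : V → ℕ)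
    (h : ∀ v ∈ S, ∃ u, F.Adj v u ∧ rank u < rank v) : S.card ≤ F.edgeFinset.card := by
  choose! par hpar hrank using h
  refine Finset.card_le_card_of_injOn (fun v => s(v, par v)) ?_ ?_
  · intro v hv
    simpa using hpar v hv
  · intro v hv w hw hvw
    have hv' := hrank v hv
    have hw' := hrank w hw
    rcases Sym2.eq_iff.1 hvw with ⟨h1, -⟩ | ⟨h1, h2⟩
    · exact h1
    · rw [h2] at hv'
      rw [← h1] at hw'
      omega

/-- If `root` picks one vertex of every component then the other vertices inject into the
edges. -/
theorem card_nonroots_le (F : SimpleGraph V) (root : F.ConnectedComponent → V)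
    (hroot : ∀ K, F.connectedComponentMk (root K) = K) :
    (Finset.univ.filter fun v => root (F.connectedComponentMk v) ≠ v).card
      ≤ F.edgeFinset.card := by
  refine card_le_card_edgeFinset_of_rank F _
    (fun v => F.dist (root (F.connectedComponentMk v)) v) ?_
  intro v hv
  simp only [Finset.mem_filter, Finset.mem_univ, true_and] at hv
  have hr : F.Reachable (root (F.connectedComponentMk v)) v :=
    ConnectedComponent.exact (hroot _)
  have hK : ∀ u, F.Adj v u → F.connectedComponentMk u = F.connectedComponentMk v :=
    fun u hadj => ConnectedComponent.sound hadj.symm.reachable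
  generalize hrr : root (F.connectedComponentMk v) = r at hr hv
  obtain ⟨p, hp⟩ := hr.symm.exists_walk_length_eq_dist
  cases p with
  | nil => exact absurd rfl hv
  | cons hadj q =>
    rename_i u
    refine ⟨u, hadj, ?_⟩
    simp only [hK u hadj, hrr]
    have h1 := F.dist_le q
    rw [Walk.length_cons] at hp
    rw [F.dist_comm, F.dist_comm (v := v)]
    omega

/-- Vertices reachable from `r` number at most one more than the edges. -/
theorem card_reachable_le (F : SimpleGraph V) (r : V) (S : Finset V)
    (h : ∀ v ∈ S, F.Reachable r v) : S.card ≤ F.edgeFinset.card + 1 := by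
  have h1 : (S.erase r).card ≤ F.edgeFinset.card := by
    refine card_le_card_edgeFinset_of_rank F _ (fun v => F.dist r v) ?_
    intro v hv
    rw [Finset.mem_erase] at hv
    obtain ⟨p, hp⟩ := (h v hv.2).symm.exists_walk_length_eq_dist
    cases p with
    | nil => exact absurd rfl hv.1
    | cons hadj q =>
      rename_i u
      refine ⟨u, hadj, ?_⟩
      have h1 := F.dist_le q
      rw [Walk.length_cons] at hp
      rw [F.dist_comm, F.dist_comm (v := v)]
      omega
  have := Finset.pred_card_le_card_erase (s := S) (a := r)
  omega

end Counting

/-! ### Color classes, links and lost colors -/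

namespace TotalColoring

variable {V : Type*} {G : SimpleGraph V} (col : G.TotalColoring)

/-- Two vertices are linked in color `c` if a total monochromatic path of color `c` joins them. -/
def Linked (c : ℕ) (u v : V) : Prop :=
  ∃ p : G.Walk u v, p.IsPath ∧
    (∀ e (he : e ∈ p.edges), col (Sum.inr ⟨e, p.edges_subset_edgeSet he⟩) = c) ∧
    (∀ w ∈ p.support, w ≠ u → w ≠ v → col (Sum.inl w) = c)

/-- The graph of the edges of color `c`. -/
def colorGraph (c : ℕ) : SimpleGraph V where
  Adj u v := ∃ h : G.Adj u v, col (Sum.inr ⟨s(u, v), h⟩) = c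
  symm := ⟨by
    rintro u v ⟨h, hc⟩
    refine ⟨h.symm, ?_⟩
    rw [← hc]
    congr 2
    exact Subtype.ext Sym2.eq_swap⟩
  loopless := ⟨fun u ⟨h, _⟩ => G.loopless.irrefl u h⟩

variable {col}

theorem IsTMC.exists_linked (h : col.IsTMC) (u v : V) : ∃ c, col.Linked c u v := by
  obtain ⟨p, hp, c, h1, h2⟩ := h u v
  exact ⟨c, p, hp, h1, h2⟩

theorem Linked.symm {c : ℕ} {u v : V} (h : col.Linked c u v) : col.Linked c v u := by
  obtain ⟨p, hp, h1, h2⟩ := h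
  refine ⟨p.reverse, hp.reverse, fun e he => ?_, fun w hw hv hu => h2 w (by simpa using hw) hu hv⟩
  exact h1 e (by simpa using he)

/-- This forgets the vertex colors. It serves to show that the edges of one color connect many
vertices, hence are many. -/
theorem Linked.reachable {c : ℕ} {u v : V} (h : col.Linked c u v) :
    (col.colorGraph c).Reachable u v := by
  obtain ⟨p, -, h1, -⟩ := h
  induction p with
  | nil => exact Reachable.refl _
  | cons hadj q ih =>
    refine Reachable.trans (Adj.reachable ⟨hadj, h1 _ (by simp)⟩) (ih fun e he => h1 e ?_)
    simp [he]

/-- A linking path leaves every vertex set that separates its ends, along an edge of its color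
whose ends are inner vertices or ends of the path. -/
theorem Linked.crossing {c : ℕ} {u v : V} (h : col.Linked c u v) (S : Set V) (hu : u ∈ S)
    (hv : v ∉ S) : ∃ a b, a ∈ S ∧ b ∉ S ∧ (col.colorGraph c).Adj a b ∧
      (a = u ∨ col (Sum.inl a) = c) ∧ (b = v ∨ col (Sum.inl b) = c) := by
  obtain ⟨p, -, h1, h2⟩ := h
  obtain ⟨d, hd, ha, hb⟩ := p.exists_boundary_dart S hu hv
  refine ⟨d.fst, d.snd, ha, hb, ⟨d.adj, h1 _ ?_⟩, ?_, ?_⟩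
  · exact List.mem_map.2 ⟨d, hd, rfl⟩
  · by_cases hau : d.fst = u
    · exact Or.inl hau
    · exact Or.inr (h2 _ (p.dart_fst_mem_support_of_mem_darts hd) hau (fun h => hv (h ▸ ha)))
  · by_cases hbv : d.snd = v
    · exact Or.inl hbv
    · exact Or.inr (h2 _ (p.dart_snd_mem_support_of_mem_darts hd) (fun h => hb (h ▸ hu)) hbv)

section Size

open scoped Classical

variable [Fintype V] (col)

/-- The vertices of color `c`. -/
noncomputable def vertexClass (c : ℕ) : Finset V :=
  Finset.univ.filter fun v => col (Sum.inl v) = c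

theorem mem_vertexClass {c : ℕ} {v : V} : v ∈ col.vertexClass c ↔ col (Sum.inl v) = c := by
  simp [vertexClass]

theorem card_fiber (c : ℕ) :
    (Finset.univ.filter fun x => col x = c).card
      = (col.colorGraph c).edgeFinset.card + (col.vertexClass c).card := by
  have h1 : (Finset.univ.filter fun x => col x = c)
      = ((col.vertexClass c).map ⟨Sum.inl, Sum.inl_injective⟩) ∪
        ((Finset.univ.filter fun e => col (Sum.inr e) = c).map ⟨Sum.inr, Sum.inr_injective⟩) := by
    ext (x | x) <;> simp [vertexClass]
  rw [h1, Finset.card_union_of_disjoint, Finset.card_map, Finset.card_map, add_comm]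
  · congr 1
    refine Finset.card_bij (fun e _ => e.1) ?_ ?_ ?_
    · rintro ⟨e, he⟩ h
      simp only [Finset.mem_filter, Finset.mem_univ, true_and] at h
      induction e using Sym2.ind with
      | _ x y => simpa using ⟨he, h⟩
    · intro a _ b _ hab
      exact Subtype.ext hab
    · intro e he
      induction e using Sym2.ind with
      | _ x y =>
        rw [mem_edgeFinset, mem_edgeSet] at he
        obtain ⟨h, hc⟩ := he
        exact ⟨⟨s(x, y), h⟩, by simpa using hc, rfl⟩
  · rw [Finset.disjoint_left]
    rintro (x | x) <;> simp

theorem numColors_eq : col.numColors = (Finset.univ.image col).card := by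
  rw [numColors, ← Set.ncard_coe_finset]
  simp

/-- If every used color `c` occurs more than `w c` times, at least the sum of the `w c` colors
are lost. -/
theorem numColors_add_sum_le (w : ℕ → ℕ) (C : Finset ℕ)
    (hw : ∀ c ∈ C, w c = 0 ∨
      w c + 1 ≤ (col.colorGraph c).edgeFinset.card + (col.vertexClass c).card) :
    col.numColors + ∑ c ∈ C, w c ≤ G.edgeFinset.card + Fintype.card V := by
  have htot : G.edgeFinset.card + Fintype.card V
      = ∑ c ∈ Finset.univ.image col, (Finset.univ.filter fun x => col x = c).card := by
    rw [← Finset.card_eq_sum_card_image, Finset.card_univ, Fintype.card_sum,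
      edgeFinset_card, add_comm]
  have h1 : ∀ c ∈ Finset.univ.image col,
      1 + (if c ∈ C then w c else 0) ≤ (Finset.univ.filter fun x => col x = c).card := by
    intro c hc
    have hpos : 1 ≤ (Finset.univ.filter fun x => col x = c).card := by
      obtain ⟨x, -, hx⟩ := Finset.mem_image.1 hc
      exact Finset.card_pos.2 ⟨x, by simpa using hx⟩
    split_ifs with hcC
    · rcases hw c hcC with h | h
      · omega
      · rw [card_fiber]; omega
    · omega
  have h2 : ∑ c ∈ C, w c ≤ ∑ c ∈ Finset.univ.image col, (if c ∈ C then w c else 0) := by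
    rw [← Finset.sum_filter]
    have : ∑ c ∈ C.filter (fun c => w c ≠ 0), w c = ∑ c ∈ C, w c :=
      Finset.sum_filter_ne_zero C
    rw [← this]
    refine Finset.sum_le_sum_of_subset ?_
    intro c hc
    rw [Finset.mem_filter] at hc ⊢
    refine ⟨?_, hc.1⟩
    rcases hw c hc.1 with h | h
    · exact absurd h hc.2
    · rw [← card_fiber] at h
      obtain ⟨x, hx⟩ := Finset.card_pos.1 (lt_of_lt_of_le (Nat.succ_pos _) h)
      exact Finset.mem_image.2 ⟨x, Finset.mem_univ _, by simpa using hx⟩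
  have h3 := Finset.sum_le_sum h1
  rw [Finset.sum_add_distrib, ← htot] at h3
  simp only [Finset.sum_const, smul_eq_mul, mul_one] at h3
  rw [numColors_eq]
  omega

end Size

end TotalColoring

/-- A bound on the number of colors of all TMC-colorings bounds `tmc`. -/
theorem tmc_le_of_forall {V : Type*} {G : SimpleGraph V} {N : ℕ}
    (h : ∀ col : G.TotalColoring, col.IsTMC → col.numColors ≤ N) : G.tmc ≤ N := by
  rw [tmc]
  refine csSup_le' ?_
  rintro _ ⟨col, hcol, rfl⟩
  exact h col hcol

/-! ### Upper bound from vertices with a non-neighbor -/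

section UpperBound

open scoped Classical
open TotalColoring

variable {V : Type*} [Fintype V] {G : SimpleGraph V}

/-- The ends of the nonadjacent pairs linked in color `c` are fewer than the edges and vertices of
color `c`. -/
theorem TotalColoring.card_lt_of_linked (col : G.TotalColoring) (c : ℕ) (X : Finset V)
    (hne : X.Nonempty)
    (hX : ∀ x ∈ X, ∃ y, y ≠ x ∧ ¬ G.Adj x y ∧ col.Linked c x y) :
    X.card + 1 ≤ (col.colorGraph c).edgeFinset.card + (col.vertexClass c).card := by
  set F := col.colorGraph c with hF
  have hmid : ∀ x ∈ X, ∃ w, F.Adj x w ∧ col (Sum.inl w) = c := by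
    intro x hx
    obtain ⟨y, hyx, hadj, hl⟩ := hX x hx
    obtain ⟨a, b, ha, hb, hab, -, h2⟩ := hl.crossing {x} rfl hyx
    rw [Set.mem_singleton_iff] at ha
    subst ha
    rcases h2 with rfl | h2
    · exact absurd hab.1 hadj
    · exact ⟨b, hab, h2⟩
  -- Each component is rooted outside `X` if possible, and otherwise at a vertex of color `c`. Thus
  -- members of `X` are paid for by edges, except for roots in `X`, which pay for themselves as
  -- vertices of color `c`.
  have hroot : ∀ K : F.ConnectedComponent, ∃ r, F.connectedComponentMk r = K ∧
      (r ∈ X → col (Sum.inl r) = c) := by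
    intro K
    by_cases hK : ∃ r, F.connectedComponentMk r = K ∧ r ∉ X
    · obtain ⟨r, hr, hrX⟩ := hK
      exact ⟨r, hr, fun h => absurd h hrX⟩
    · obtain ⟨x, rfl⟩ := K.exists_rep
      by_cases hx : x ∈ X
      · obtain ⟨w, hw, hwc⟩ := hmid x hx
        exact ⟨w, ConnectedComponent.sound hw.symm.reachable, fun _ => hwc⟩
      · exact ⟨x, rfl, fun h => absurd h hx⟩
  choose root hroot hrootc using hroot
  set S := Finset.univ.filter fun v => root (F.connectedComponentMk v) ≠ v with hS
  have hSc : S.card ≤ F.edgeFinset.card := card_nonroots_le F root hroot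
  have hsplit : X.card ≤ S.card + (X \ S).card := by
    have := Finset.card_le_card (show X ⊆ S ∪ (X \ S) by intro x hx; simp; tauto)
    exact this.trans (Finset.card_union_le _ _)
  have hXS : ∀ r ∈ X \ S, root (F.connectedComponentMk r) = r ∧ r ∈ X := by
    intro r hr
    simp only [hS, Finset.mem_sdiff, Finset.mem_filter, Finset.mem_univ, true_and, not_not] at hr
    exact ⟨hr.2, hr.1⟩
  -- The extra unit is the first inner vertex `w` of a link: it has color `c`, and if its neighbor
  -- `r` is a root then `w` is not.
  have hcol : (X \ S).card + 1 ≤ (col.vertexClass c).card := by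
    rcases (X \ S).eq_empty_or_nonempty with h0 | ⟨r, hr⟩
    · obtain ⟨x, hx⟩ := hne
      obtain ⟨w, -, hw⟩ := hmid x hx
      rw [h0, Finset.card_empty]
      exact Finset.card_pos.2 ⟨w, by rwa [mem_vertexClass]⟩
    · obtain ⟨hr1, hrX⟩ := hXS r hr
      obtain ⟨w, hw, hwc⟩ := hmid r hrX
      have hwn : w ∉ X \ S := by
        intro hwm
        have h1 := (hXS w hwm).1
        rw [show F.connectedComponentMk w = F.connectedComponentMk r from
          ConnectedComponent.sound hw.symm.reachable, hr1] at h1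
        exact hw.ne h1
      rw [← Finset.card_insert_of_notMem hwn]
      refine Finset.card_le_card ?_
      intro v hv
      rw [mem_vertexClass]
      rcases Finset.mem_insert.1 hv with rfl | hv
      · exact hwc
      · obtain ⟨h1, h2⟩ := hXS v hv
        have := hrootc (F.connectedComponentMk v)
        rw [h1] at this
        exact this h2
  omega

/-- Every vertex that is not adjacent to all others costs a color. -/
theorem tmc_add_card_le (X : Finset V) (hX : ∀ x ∈ X, ∃ y, y ≠ x ∧ ¬ G.Adj x y) :
    G.tmc + X.card ≤ G.edgeFinset.card + Fintype.card V := by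
  have hle : X.card ≤ G.edgeFinset.card + Fintype.card V :=
    (Finset.card_le_univ X).trans (Nat.le_add_left _ _)
  suffices h : G.tmc ≤ G.edgeFinset.card + Fintype.card V - X.card by omega
  refine tmc_le_of_forall fun col hcol => ?_
  choose! y hy hadj using hX
  choose ψ hψ using fun x => hcol.exists_linked x (y x)
  have h1 := col.numColors_add_sum_le (fun c => (X.filter fun x => ψ x = c).card) (X.image ψ) ?_
  · rw [← Finset.card_eq_sum_card_image] at h1
    omega
  · intro c hc
    right
    refine col.card_lt_of_linked c _ ?_ ?_
    · obtain ⟨x, hx, rfl⟩ := Finset.mem_image.1 hc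
      exact ⟨x, by simp [hx]⟩
    · intro x hx
      rw [Finset.mem_filter] at hx
      exact ⟨y x, hy x hx.1, hadj x hx.1, hx.2 ▸ hψ x⟩

end UpperBound

/-! ### Upper bound from a pendant path -/

section PendantPath

open scoped Classical
open TotalColoring

/-- Graphs on `Fin n` ending in the pendant path `t, …, n - 1`, where `t` misses an earlier
vertex. -/
theorem tmc_add_le_of_pendant_path {n t : ℕ} (ht : 1 ≤ t) (htn : t + 2 ≤ n)
    {G : SimpleGraph (Fin n)} (hm : n ≤ G.edgeFinset.card + 1)
    (hpath : ∀ i j : Fin n, i < j → t < j.1 → G.Adj i j → i.1 + 1 = j.1)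
    (hnon : ∃ i j : Fin n, i.1 < t ∧ j.1 = t ∧ ¬ G.Adj i j) :
    G.tmc + n ≤ G.edgeFinset.card + t + 2 := by
  -- One class has at least n - 1 edges and n - t vertices, so it wastes 2n - 2 - t colors.
  suffices h : G.tmc ≤ G.edgeFinset.card + n - (2 * n - 2 - t) by omega
  refine tmc_le_of_forall fun col hcol => ?_
  obtain ⟨i0, j0, hi0, hj0, hadj⟩ := hnon
  set e : Fin n := ⟨n - 1, by omega⟩ with he
  -- The set of vertices up to `k` can only be left along the tail edge from `k` to `k + 1`.
  have hcut : ∀ (c : ℕ) (u : Fin n), col.Linked c u e → ∀ k : ℕ, t ≤ k → u.1 ≤ k →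
      (hk : k + 1 < n) → (col.colorGraph c).Adj ⟨k, by omega⟩ ⟨k + 1, hk⟩ ∧
        (u.1 ≠ k → col (Sum.inl ⟨k, by omega⟩) = c) := by
    intro c u hl k htk huk hk
    obtain ⟨a, b, ha, hb, hab, h1, -⟩ := hl.crossing {i | i.1 ≤ k} huk
      (by simp only [he, Set.mem_ofPred_eq]; omega)
    simp only [Set.mem_ofPred_eq, not_le] at ha hb
    have hstep := hpath a b (Fin.lt_def.2 (by omega)) (by omega) hab.1
    have ha' : a = ⟨k, by omega⟩ := Fin.ext (by simp only; omega)
    have hb' : b = ⟨k + 1, hk⟩ := Fin.ext (by simp only; omega)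
    rw [← ha', ← hb']
    refine ⟨hab, fun hne => h1.resolve_left fun h => hne ?_⟩
    rw [← h, ha']
  obtain ⟨c, hc⟩ := hcol.exists_linked ⟨0, by omega⟩ e
  -- The link from `u` and the link from vertex 0 both use the tail edge that starts at `max u t`,
  -- so their colors agree.
  have hsame : ∀ u : Fin n, u ≠ e → col.Linked c u e := by
    intro u hu
    obtain ⟨c', hc'⟩ := hcol.exists_linked u e
    have hun : u.1 + 1 < n := by
      have := u.2
      have : u.1 ≠ n - 1 := fun h => hu (Fin.ext h)
      omega
    have h1 := (hcut c' u hc' (max u.1 t) (le_max_right _ _) (le_max_left _ _) (by omega)).1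
    have h2 := (hcut c _ hc (max u.1 t) (le_max_right _ _) (Nat.zero_le _) (by omega)).1
    obtain ⟨_, h1⟩ := h1
    obtain ⟨_, h2⟩ := h2
    rwa [← h2, h1]
  have hedge : n ≤ (col.colorGraph c).edgeFinset.card + 1 := by
    have := card_reachable_le (col.colorGraph c) e Finset.univ (fun v _ => by
      by_cases hv : v = e
      · rw [hv]
      · exact (hsame v hv).reachable.symm)
    simpa using this
  have hvert : n - t ≤ (col.vertexClass c).card := by
    obtain ⟨a, b, ha, hb, hab, h1, -⟩ := (hsame i0 (by rw [Ne, Fin.ext_iff]; simp only [he]; omega)).crossing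
      {i | i.1 < t} hi0 (by simp only [he, Set.mem_ofPred_eq]; omega)
    simp only [Set.mem_ofPred_eq, not_lt] at ha hb
    have hbt : b.1 = t := by
      by_contra hne
      have := hpath a b (Fin.lt_def.2 (by omega)) (by omega) hab.1
      omega
    -- The link from `i0` enters the tail at `t` from a vertex other than `i0`, because `i0` is not
    -- adjacent to `t`. This gives a vertex of color `c` before the tail.
    have hac : col (Sum.inl a) = c := by
      refine h1.resolve_left ?_
      rintro rfl
      obtain rfl : b = j0 := Fin.ext (by omega)
      exact hadj hab.1
    have h3 : insert a (Finset.univ.filter fun i : Fin n => t ≤ i.1 ∧ i.1 + 1 < n)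
        ⊆ col.vertexClass c := by
      intro v hv
      rw [mem_vertexClass]
      rcases Finset.mem_insert.1 hv with rfl | hv
      · exact hac
      · simp only [Finset.mem_filter, Finset.mem_univ, true_and] at hv
        refine (hcut c _ hc v.1 hv.1 (Nat.zero_le _) hv.2).2 ?_
        simp only
        omega
    have h4 : n - t - 1 ≤ (Finset.univ.filter fun i : Fin n => t ≤ i.1 ∧ i.1 + 1 < n).card := by
      have : (Finset.Ico t (n - 1)).card
          ≤ (Finset.univ.filter fun i : Fin n => t ≤ i.1 ∧ i.1 + 1 < n).card := by
        refine Finset.card_le_card_of_surjOn (fun i : Fin n => i.1) ?_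
        intro k hk
        simp only [Finset.coe_Ico, Set.mem_Ico] at hk
        exact ⟨⟨k, by omega⟩, by simp; omega, rfl⟩
      rw [Nat.card_Ico] at this
      omega
    have h5 := Finset.card_le_card h3
    rw [Finset.card_insert_of_notMem (by simp; omega)] at h5
    omega
  have := col.numColors_add_sum_le (fun _ => 2 * n - 2 - t) {c} (by
    intro c' hc'
    rw [Finset.mem_singleton] at hc'
    subst hc'
    right
    omega)
  simp only [Finset.sum_singleton, Fintype.card_fin] at this
  omega

end PendantPath

/-! ### Upper bound from a long path with inner vertices of degree two -/

section Theta

open scoped Classical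
open TotalColoring

variable {V : Type*} {G : SimpleGraph V}

/-- `p 0, …, p j` is a path with inner vertices of degree two and nonadjacent ends, and `A` is the
set of the other vertices. -/
structure IsTheta (G : SimpleGraph V) (j : ℕ) (p : ℕ → V) (A : Finset V) : Prop where
  three_le : 3 ≤ j
  nonempty : A.Nonempty
  inj : ∀ a ≤ j, ∀ b ≤ j, p a = p b → a = b
  notMem : ∀ a ≤ j, p a ∉ A
  cover : ∀ v, v ∈ A ∨ ∃ a ≤ j, v = p a
  adj : ∀ a < j, G.Adj (p a) (p (a + 1))
  inner : ∀ a, 0 < a → a < j → ∀ x, G.Adj (p a) x → x = p (a - 1) ∨ x = p (a + 1)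
  ends : ¬ G.Adj (p 0) (p j)

namespace IsTheta

variable {j : ℕ} {p : ℕ → V} {A : Finset V}

/-- Reversal of the path reduces the case of an exceptional last edge to that of an exceptional
first edge. -/
theorem reflect (h : IsTheta G j p A) : IsTheta G j (fun a => p (j - a)) A where
  three_le := h.three_le
  nonempty := h.nonempty
  inj a ha b hb hab := by
    have := h.inj _ (Nat.sub_le _ _) _ (Nat.sub_le _ _) hab
    omega
  notMem a _ := h.notMem _ (Nat.sub_le _ _)
  cover v := by
    rcases h.cover v with hv | ⟨a, ha, rfl⟩
    · exact Or.inl hv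
    · exact Or.inr ⟨j - a, Nat.sub_le _ _, by simp only [Nat.sub_sub_self ha]⟩
  adj a ha := by
    have := h.adj (j - (a + 1)) (by omega)
    rw [show j - (a + 1) + 1 = j - a by omega] at this
    exact this.symm
  inner a h0 ha x hx := by
    have := h.inner (j - a) (by omega) (by omega) x hx
    rw [show j - a - 1 = j - (a + 1) by omega, show j - a + 1 = j - (a - 1) by omega] at this
    exact this.symm
  ends hadj := by
    refine h.ends ?_
    simpa using hadj.symm

theorem ne_of_ne (h : IsTheta G j p A) {a b : ℕ} (ha : a ≤ j) (hb : b ≤ j) (hab : a ≠ b) :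
    p a ≠ p b := fun he => hab (h.inj a ha b hb he)

variable {col : G.TotalColoring} {c : ℕ}

/-- The segment strictly after `p a` up to `p b` consists of vertices of degree two, so only its two
end edges lead out of it. -/
theorem cut_mid (h : IsTheta G j p A) {x y : V} (hl : col.Linked c x y) {a b : ℕ}
    (hab : a < b) (hbj : b < j) (hx : ∃ i, a < i ∧ i ≤ b ∧ x = p i)
    (hy : ∀ i, a < i → i ≤ b → y ≠ p i) :
    ((col.colorGraph c).Adj (p a) (p (a + 1)) ∧ (p (a + 1) = x ∨ col (Sum.inl (p (a + 1))) = c) ∧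
      (p a = y ∨ col (Sum.inl (p a)) = c)) ∨
    ((col.colorGraph c).Adj (p b) (p (b + 1)) ∧ (p b = x ∨ col (Sum.inl (p b)) = c) ∧
      (p (b + 1) = y ∨ col (Sum.inl (p (b + 1))) = c)) := by
  obtain ⟨u, v, hu, hv, huv, h1, h2⟩ := hl.crossing {z | ∃ i, a < i ∧ i ≤ b ∧ z = p i} hx
    (by rintro ⟨i, hi1, hi2, hi3⟩; exact hy i hi1 hi2 hi3)
  obtain ⟨i, hi1, hi2, rfl⟩ := hu
  rcases h.inner i (by omega) (by omega) v huv.1 with rfl | rfl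
  · have : i = a + 1 := by
      by_contra hne
      exact hv ⟨i - 1, by omega, by omega, rfl⟩
    subst this
    exact Or.inl ⟨huv.symm, h1, h2⟩
  · have : i = b := by
      by_contra hne
      exact hv ⟨i + 1, by omega, by omega, rfl⟩
    subst this
    exact Or.inr ⟨huv, h1, h2⟩

/-- The final segment has no exit to `p 0` from `p j`, these being nonadjacent. A link leaves it
along the path or through a vertex of `A`. -/
theorem cut_end (h : IsTheta G j p A) {x y : V} (hl : col.Linked c x y) {a : ℕ}
    (haj : a < j) (hx : ∃ i, a < i ∧ i ≤ j ∧ x = p i)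
    (hy : ∀ i, a < i → i ≤ j → y ≠ p i) :
    ((col.colorGraph c).Adj (p a) (p (a + 1)) ∧ (p (a + 1) = x ∨ col (Sum.inl (p (a + 1))) = c) ∧
      (p a = y ∨ col (Sum.inl (p a)) = c)) ∨
    ∃ q ∈ A, q = y ∨ col (Sum.inl q) = c := by
  obtain ⟨u, v, hu, hv, huv, h1, h2⟩ := hl.crossing {z | ∃ i, a < i ∧ i ≤ j ∧ z = p i} hx
    (by rintro ⟨i, hi1, hi2, hi3⟩; exact hy i hi1 hi2 hi3)
  obtain ⟨i, hi1, hi2, rfl⟩ := hu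
  rcases h.cover v with hvA | ⟨k, hk, rfl⟩
  · exact Or.inr ⟨v, hvA, h2⟩
  have hka : k ≤ a := by
    by_contra hne
    exact hv ⟨k, by omega, hk, rfl⟩
  have hi : i = k + 1 := by
    rcases Nat.eq_zero_or_pos k with rfl | hk0
    · rcases Nat.lt_or_ge i j with hij | hij
      · rcases h.inner i (by omega) hij _ huv.1 with h' | h'
        · have := h.inj _ hk _ (by omega) h'
          omega
        · have := h.inj _ hk _ (by omega) h'
          omega
      · obtain rfl : i = j := by omega
        exact absurd huv.1.symm h.ends
    · rcases h.inner k hk0 (by omega) _ huv.1.symm with h' | h'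
      · have := h.inj _ hi2 _ (by omega) h'
        omega
      · exact h.inj _ hi2 _ (by omega) h'
  obtain rfl : k = a := by omega
  subst hi
  exact Or.inl ⟨huv.symm, h1, h2⟩

theorem reachable_of_edges {a b : ℕ} (hab : a ≤ b)
    (he : ∀ i, a ≤ i → i < b → (col.colorGraph c).Adj (p i) (p (i + 1))) :
    (col.colorGraph c).Reachable (p a) (p b) := by
  induction b, hab using Nat.le_induction with
  | base => exact Reachable.refl _
  | succ b hab ih =>
    exact (ih fun i h1 h2 => he i h1 (by omega)).trans (he b hab (by omega)).reachable

theorem color_unique {c' : ℕ} {u v : V} (h1 : (col.colorGraph c).Adj u v)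
    (h2 : (col.colorGraph c').Adj u v) : c = c' := by
  obtain ⟨_, h1⟩ := h1
  obtain ⟨_, h2⟩ := h2
  rw [← h1, h2]

/-- Where the color changes along the path, the two neighbours of the vertex are linked through
all the other edges of the path. -/
theorem of_change (h : IsTheta G j p A) (hcol : col.IsTMC) {i : ℕ} (hij : i + 1 < j)
    (hch : ∀ c, ¬ ((col.colorGraph c).Adj (p i) (p (i + 1)) ∧
      (col.colorGraph c).Adj (p (i + 1)) (p (i + 2)))) :
    ∃ c, col.Linked c (p i) (p (i + 2)) ∧
      (∀ b < j, b ≠ i → b ≠ i + 1 → (col.colorGraph c).Adj (p b) (p (b + 1)) ∧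
        (b ≠ i + 2 → col (Sum.inl (p b)) = c) ∧ (b + 1 ≠ i → col (Sum.inl (p (b + 1))) = c)) ∧
      ∃ q ∈ A, col (Sum.inl q) = c := by
  obtain ⟨c, hc⟩ := hcol.exists_linked (p i) (p (i + 2))
  refine ⟨c, hc, ?_, ?_⟩
  · intro b hbj hbi hbi'
    rcases not_and_or.1 (hch c) with hn | hn
    · rcases Nat.lt_or_ge b i with hlt | hge
      · rcases h.cut_mid hc hlt (by omega) ⟨i, hlt, le_rfl, rfl⟩
          (fun k h1 h2 => h.ne_of_ne (by omega) (by omega) (by omega)) with hh | hh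
        · refine ⟨hh.1, fun _ => hh.2.2.resolve_left (h.ne_of_ne (by omega) (by omega) (by omega)),
            fun hne => hh.2.1.resolve_left (h.ne_of_ne (by omega) (by omega) (by omega))⟩
        · exact absurd hh.1 hn
      · rcases h.cut_mid hc.symm (show i < b by omega) hbj ⟨i + 2, by omega, by omega, rfl⟩
          (fun k h1 h2 => h.ne_of_ne (by omega) (by omega) (by omega)) with hh | hh
        · exact absurd hh.1 hn
        · refine ⟨hh.1, fun _ => hh.2.1.resolve_left (h.ne_of_ne (by omega) (by omega) (by omega)),
            fun hne => hh.2.2.resolve_left (h.ne_of_ne (by omega) (by omega) (by omega))⟩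
    · rcases Nat.lt_or_ge b i with hlt | hge
      · rcases h.cut_mid hc (show b < i + 1 by omega) (by omega) ⟨i, hlt, by omega, rfl⟩
          (fun k h1 h2 => h.ne_of_ne (by omega) (by omega) (by omega)) with hh | hh
        · refine ⟨hh.1, fun _ => hh.2.2.resolve_left (h.ne_of_ne (by omega) (by omega) (by omega)),
            fun hne => hh.2.1.resolve_left (h.ne_of_ne (by omega) (by omega) (by omega))⟩
        · exact absurd hh.1 hn
      · rcases h.cut_mid hc.symm (show i + 1 < b by omega) hbj ⟨i + 2, by omega, by omega, rfl⟩
          (fun k h1 h2 => h.ne_of_ne (by omega) (by omega) (by omega)) with hh | hh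
        · exact absurd hh.1 hn
        · refine ⟨hh.1, fun _ => hh.2.1.resolve_left (h.ne_of_ne (by omega) (by omega) (by omega)),
            fun hne => hh.2.2.resolve_left (h.ne_of_ne (by omega) (by omega) (by omega))⟩
  · have key : ∀ a, i ≤ a → a < i + 2 → ¬ (col.colorGraph c).Adj (p a) (p (a + 1)) →
        ∃ q ∈ A, col (Sum.inl q) = c := by
      intro a ha1 ha2 hn
      rcases h.cut_end hc.symm (show a < j by omega) ⟨i + 2, by omega, by omega, rfl⟩
        (fun k h1 h2 => h.ne_of_ne (by omega) (by omega) (by omega)) with hh | ⟨q, hq, hh⟩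
      · exact absurd hh.1 hn
      · refine ⟨q, hq, hh.resolve_left ?_⟩
        rintro rfl
        exact h.notMem i (by omega) hq
    rcases not_and_or.1 (hch c) with hn | hn
    · exact key i le_rfl (by omega) hn
    · exact key (i + 1) (by omega) (by omega) hn

variable [Fintype V]

theorem card_eq (h : IsTheta G j p A) : Fintype.card V = A.card + j + 1 := by
  have h1 : (Finset.univ : Finset V) = A ∪ (Finset.range (j + 1)).image p := by
    ext v
    simp only [Finset.mem_univ, Finset.mem_union, Finset.mem_image, Finset.mem_range, true_iff]
    rcases h.cover v with hv | ⟨a, ha, rfl⟩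
    · exact Or.inl hv
    · exact Or.inr ⟨a, by omega, rfl⟩
  rw [← Finset.card_univ, h1, Finset.card_union_of_disjoint, Finset.card_image_of_injOn,
    Finset.card_range, add_assoc]
  · intro a ha b hb hab
    simp only [Finset.coe_range, Set.mem_Iio] at ha hb
    exact h.inj a (by omega) b (by omega) hab
  · rw [Finset.disjoint_left]
    intro v hv hv'
    obtain ⟨a, ha, rfl⟩ := Finset.mem_image.1 hv'
    exact h.notMem a (by rw [Finset.mem_range] at ha; omega) hv

theorem card_vertexClass (h : IsTheta G j p A) {I : Finset ℕ} (hI : ∀ i ∈ I, i ≤ j)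
    (hp : ∀ i ∈ I, col (Sum.inl (p i)) = c) : I.card ≤ (col.vertexClass c).card := by
  refine Finset.card_le_card_of_injOn p ?_ ?_
  · intro i hi
    simpa [mem_vertexClass] using hp i hi
  · intro a ha b hb hab
    exact h.inj a (hI a ha) b (hI b hb) hab

theorem card_vertexClass' (h : IsTheta G j p A) {I : Finset ℕ} (hI : ∀ i ∈ I, i ≤ j)
    (hp : ∀ i ∈ I, col (Sum.inl (p i)) = c) (hA : ∃ q ∈ A, col (Sum.inl q) = c) :
    I.card + 1 ≤ (col.vertexClass c).card := by
  obtain ⟨q, hq, hqc⟩ := hA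
  have hinj : Set.InjOn p I := fun a ha b hb hab => h.inj a (hI a ha) b (hI b hb) hab
  rw [← Finset.card_image_of_injOn hinj, ← Finset.card_insert_of_notMem (a := q)]
  · refine Finset.card_le_card ?_
    intro v hv
    rw [mem_vertexClass]
    rcases Finset.mem_insert.1 hv with rfl | hv
    · exact hqc
    · obtain ⟨i, hi, rfl⟩ := Finset.mem_image.1 hv
      exact hp i hi
  · intro hv
    obtain ⟨i, hi, rfl⟩ := Finset.mem_image.1 hv
    exact h.notMem i (hI i hi) hq

theorem card_edges_of_spanning (h : IsTheta G j p A)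
    (hp : ∀ i ≤ j, (col.colorGraph c).Reachable (p j) (p i))
    (hA : ∀ q ∈ A, (col.colorGraph c).Reachable (p j) q) :
    A.card + j ≤ (col.colorGraph c).edgeFinset.card := by
  have := card_reachable_le (col.colorGraph c) (p j) Finset.univ (fun v _ => by
    rcases h.cover v with hv | ⟨a, ha, rfl⟩
    · exact hA v hv
    · exact hp a ha)
  rw [Finset.card_univ, h.card_eq] at this
  omega

/-- The target loss when a single class bears it: |A| + j edges connecting everything and j
vertices. -/
theorem numColors_le_of_class (h : IsTheta G j p A)
    (hc : A.card + j + j ≤ (col.colorGraph c).edgeFinset.card + (col.vertexClass c).card) :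
    col.numColors + (A.card + 2 * j - 1) ≤ G.edgeFinset.card + Fintype.card V := by
  have h3 := h.three_le
  have := col.numColors_add_sum_le (fun _ => A.card + 2 * j - 1) {c} (by
    intro c' hc'
    rw [Finset.mem_singleton] at hc'
    subst hc'
    right
    omega)
  simpa using this

theorem card_range_sdiff (i : ℕ) (j : ℕ) :
    j ≤ ((Finset.range (j + 1)).filter fun b => b ≠ i ∧ b ≠ i + 1).card + 1 := by
  have h1 : Finset.range (j + 1) ⊆
      ((Finset.range (j + 1)).filter fun b => b ≠ i ∧ b ≠ i + 1) ∪ {i, i + 1} := by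
    intro b hb
    simp only [Finset.mem_union, Finset.mem_filter, Finset.mem_insert, Finset.mem_singleton]
    tauto
  have h2 := (Finset.card_le_card h1).trans (Finset.card_union_le _ _)
  have h3 : ({i, i + 1} : Finset ℕ).card ≤ 2 := Finset.card_le_two
  rw [Finset.card_range] at h2
  omega

/-- A link from an inner path vertex must use a path edge, so it has color `c`, and the edges of
color `c` connect all vertices. It remains to find j vertices of color `c`. -/
theorem numColors_le_of_const (h : IsTheta G j p A) (hcol : col.IsTMC)
    (hE : ∀ i < j, (col.colorGraph c).Adj (p i) (p (i + 1))) :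
    col.numColors + (A.card + 2 * j - 1) ≤ G.edgeFinset.card + Fintype.card V := by
  have h3 := h.three_le
  have hcolor : ∀ b, 0 < b → b < j → ∀ y, y ≠ p b → ∀ c', col.Linked c' (p b) y → c' = c := by
    intro b hb0 hbj y hy c' hl
    rcases h.cut_mid hl (show b - 1 < b by omega) hbj ⟨b, by omega, le_rfl, rfl⟩
      (fun k h1 h2 => by rwa [show k = b by omega]) with hh | hh
    · exact color_unique hh.1 (hE _ (by omega))
    · exact color_unique hh.1 (hE _ hbj)
  have hedge := h.card_edges_of_spanning
    (fun i hi => (reachable_of_edges hi fun k _ hk => hE k hk).symm)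
    (fun q hq => by
      obtain ⟨c', hc'⟩ := hcol.exists_linked (p 1) q
      have := hcolor 1 (by omega) (by omega) q
        (fun he => h.notMem 1 (by omega) (he ▸ hq)) c' hc'
      subst this
      exact (reachable_of_edges (show 1 ≤ j by omega) fun k _ hk => hE k hk).symm.trans
        hc'.reachable)
  -- A link from `p (z + 1)` to a vertex of `A` leaves the segment between `p z` and `p w` through
  -- one of these two.
  have hcons : ∀ z w, z + 1 < w → w ≤ j → col (Sum.inl (p z)) = c ∨ col (Sum.inl (p w)) = c := by
    intro z w hzw hwj
    obtain ⟨q, hq⟩ := h.nonempty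
    have hqp : ∀ i ≤ j, p i ≠ q := fun i hi he => h.notMem i hi (he ▸ hq)
    obtain ⟨c', hc'⟩ := hcol.exists_linked (p (z + 1)) q
    have := hcolor (z + 1) (by omega) (by omega) q (hqp _ (by omega)).symm c' hc'
    subst this
    rcases h.cut_mid hc' (show z < w - 1 by omega) (by omega) ⟨z + 1, by omega, by omega, rfl⟩
      (fun k h1 h2 => (hqp k (by omega)).symm) with hh | hh
    · exact Or.inl (hh.2.2.resolve_left (hqp _ (by omega)))
    · right
      rw [show w - 1 + 1 = w by omega] at hh
      exact hh.2.2.resolve_left (hqp _ (by omega))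
  refine h.numColors_le_of_class (c := c) ?_
  -- If `A` meets the class, by `hcons` only two consecutive path vertices can lack the color, and
  -- the vertex of `A` makes up for one of them. If not, links between `p (z - 1)` and `p (z + 1)`
  -- cannot go around through `A`, so all inner vertices and one end have color `c`.
  by_cases hA : ∃ q ∈ A, col (Sum.inl q) = c
  · have : ∃ i, ∀ b ≤ j, b ≠ i → b ≠ i + 1 → col (Sum.inl (p b)) = c := by
      by_cases hex : ∃ i, i ≤ j ∧ col (Sum.inl (p i)) ≠ c
      · refine ⟨Nat.find hex, fun b hb hb1 hb2 => ?_⟩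
        by_contra hbc
        have h4 : Nat.find hex ≤ b := Nat.find_min' hex ⟨hb, hbc⟩
        rcases hcons (Nat.find hex) b (by omega) hb with h5 | h5
        · exact (Nat.find_spec hex).2 h5
        · exact hbc h5
      · push Not at hex
        exact ⟨0, fun b hb _ _ => hex b hb⟩
    obtain ⟨i, hi⟩ := this
    have := h.card_vertexClass' (c := c)
      (I := (Finset.range (j + 1)).filter fun b => b ≠ i ∧ b ≠ i + 1)
      (fun b hb => by simp at hb; omega)
      (fun b hb => by simp at hb; exact hi b (by omega) hb.2.1 hb.2.2) hA
    have := card_range_sdiff i j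
    omega
  · have hinner : ∀ z, 0 < z → z < j → col (Sum.inl (p z)) = c := by
      intro z hz0 hzj
      obtain ⟨c', hc'⟩ := hcol.exists_linked (p (z - 1)) (p (z + 1))
      have hcc : c' = c := by
        rcases Nat.lt_or_ge (z + 1) j with hlt | hge
        · exact hcolor (z + 1) (by omega) hlt _ (h.ne_of_ne (by omega) (by omega) (by omega)) _
            hc'.symm
        · exact hcolor (z - 1) (by omega) (by omega) _
            (h.ne_of_ne (by omega) (by omega) (by omega)) _ hc'
      subst hcc
      rcases h.cut_end hc'.symm hzj ⟨z + 1, by omega, by omega, rfl⟩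
        (fun k h1 h2 => h.ne_of_ne (by omega) (by omega) (by omega)) with hh | ⟨q, hq, hh⟩
      · exact hh.2.2.resolve_left (h.ne_of_ne (by omega) (by omega) (by omega))
      · refine absurd ⟨q, hq, hh.resolve_left ?_⟩ hA
        rintro rfl
        exact h.notMem _ (by omega) hq
    have : ∃ i, ∀ b ≤ j, b ≠ i → col (Sum.inl (p b)) = c := by
      rcases hcons 0 j (by omega) le_rfl with h0 | h0
      · refine ⟨j, fun b hb hbj => ?_⟩
        rcases Nat.eq_zero_or_pos b with rfl | hb0
        · exact h0
        · exact hinner b hb0 (by omega)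
      · refine ⟨0, fun b hb hbj => ?_⟩
        rcases Nat.lt_or_ge b j with hlt | hge
        · exact hinner b (by omega) hlt
        · rwa [show b = j by omega]
    obtain ⟨i, hi⟩ := this
    have := h.card_vertexClass (c := c)
      (I := (Finset.range (j + 1)).erase i)
      (fun b hb => by simp at hb; omega)
      (fun b hb => by simp at hb; exact hi b (by omega) hb.1)
    have h6 := Finset.pred_card_le_card_erase (s := Finset.range (j + 1)) (a := i)
    rw [Finset.card_range] at h6
    omega

/-- The color changes at both ends of the exceptional edge. The two detours given by `of_change`
have the common color, connect both parts of the path and color all path vertices off this edge as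
well as a vertex of `A`. -/
theorem numColors_le_of_odd_inner (h : IsTheta G j p A) (hcol : col.IsTMC) {q : ℕ} (hq0 : 0 < q)
    (hqj : q + 1 < j) (hE : ∀ i < j, i ≠ q → (col.colorGraph c).Adj (p i) (p (i + 1)))
    (hq : ¬ (col.colorGraph c).Adj (p q) (p (q + 1))) :
    col.numColors + (A.card + 2 * j - 1) ≤ G.edgeFinset.card + Fintype.card V := by
  obtain ⟨c1, hl1, hp1, hA1⟩ := h.of_change hcol hqj (fun c' hc' => by
    have := color_unique hc'.2 (hE (q + 1) hqj (by omega))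
    subst this
    exact hq hc'.1)
  have hc1 := color_unique (hp1 (q - 1) (by omega) (by omega) (by omega)).1
    (hE (q - 1) (by omega) (by omega))
  subst hc1
  obtain ⟨q, rfl⟩ : ∃ q', q = q' + 1 := ⟨q - 1, by omega⟩
  obtain ⟨c2, -, hp2, -⟩ := h.of_change hcol (i := q) (by omega) (fun c' hc' => by
    have := color_unique hc'.1 (hE q (by omega) (by omega))
    subst this
    exact hq hc'.2)
  have hc2 := color_unique (hp2 (q + 2) (by omega) (by omega) (by omega)).1
    (hE (q + 2) (by omega) (by omega))
  subst hc2
  have hup : ∀ b, q + 2 ≤ b → b ≤ j → (col.colorGraph c2).Reachable (p j) (p b) := fun b hb hbj =>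
    (reachable_of_edges hbj fun k h1 h2 => hE k h2 (by omega)).symm
  have hreach : ∀ b ≤ j, (col.colorGraph c2).Reachable (p j) (p b) := by
    intro b hbj
    rcases Nat.lt_or_ge b (q + 2) with hlt | hge
    · refine ((hup (q + 3) (by omega) (by omega)).trans hl1.symm.reachable).trans ?_
      exact (reachable_of_edges (show b ≤ q + 1 by omega)
        fun k h1 h2 => hE k (by omega) (by omega)).symm
    · exact hup b hge hbj
  have hedge := h.card_edges_of_spanning hreach (fun a ha => by
    have hap : ∀ i ≤ j, a ≠ p i := fun i hi he => h.notMem i hi (he ▸ ha)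
    obtain ⟨c', hc'⟩ := hcol.exists_linked (p 1) a
    have : c' = c2 := by
      rcases h.cut_mid hc' (show 0 < j - 1 by omega) (by omega) ⟨1, by omega, by omega, rfl⟩
        (fun k h1 h2 => hap k (by omega)) with hh | hh
      · exact color_unique hh.1 (hE _ (by omega) (by omega))
      · exact color_unique hh.1 (hE _ (by omega) (by omega))
    subst this
    exact (hreach 1 (by omega)).trans hc'.reachable)
  have := h.card_vertexClass' (c := c2)
      (I := (Finset.range (j + 1)).filter fun b => b ≠ q + 1 ∧ b ≠ q + 1 + 1)
      (fun b hb => by simp at hb; omega)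
      -- Each detour leaves its own ends uncolored, so one detour serves the vertices before the
      -- exceptional edge and the other those after it.
      (fun b hb => by
        simp only [Finset.mem_filter, Finset.mem_range] at hb
        rcases Nat.lt_or_ge b (q + 1) with hlt | hge
        · exact (hp1 b (by omega) (by omega) (by omega)).2.1 (by omega)
        · obtain ⟨b, rfl⟩ : ∃ b', b = b' + 1 := ⟨b - 1, by omega⟩
          exact (hp2 b (by omega) (by omega) (by omega)).2.2 (by omega)) hA1
  have := card_range_sdiff (q + 1) j
  refine h.numColors_le_of_class (c := c2) ?_
  omega

/-- Here the color changes only at `p 1`. The single detour leaves the main class one member short,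
and the link from `p 1` to `p j` supplies the missing unit. -/
theorem numColors_le_of_odd_first (h : IsTheta G j p A) (hcol : col.IsTMC)
    (hE : ∀ i < j, 0 < i → (col.colorGraph c).Adj (p i) (p (i + 1)))
    (hq : ¬ (col.colorGraph c).Adj (p 0) (p 1)) :
    col.numColors + (A.card + 2 * j - 1) ≤ G.edgeFinset.card + Fintype.card V := by
  have h3 := h.three_le
  obtain ⟨c1, hl1, hp1, hA1⟩ := h.of_change hcol (i := 0) (by omega) (fun c' hc' => by
    have := color_unique hc'.2 (hE 1 (by omega) (by omega))
    subst this
    exact hq hc'.1)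
  have hc1 := color_unique (hp1 2 (by omega) (by omega) (by omega)).1
    (hE 2 (by omega) (by omega))
  subst hc1
  have hup : ∀ b, 1 ≤ b → b ≤ j → (col.colorGraph c1).Reachable (p j) (p b) := fun b hb hbj =>
    (reachable_of_edges hbj fun k h1 h2 => hE k h2 (by omega)).symm
  have hreach : ∀ b ≤ j, (col.colorGraph c1).Reachable (p j) (p b) := by
    intro b hbj
    rcases Nat.eq_zero_or_pos b with rfl | hb
    · exact (hup 2 (by omega) (by omega)).trans hl1.symm.reachable
    · exact hup b hb hbj
  have hedge := h.card_edges_of_spanning hreach (fun a ha => by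
    have hap : ∀ i ≤ j, a ≠ p i := fun i hi he => h.notMem i hi (he ▸ ha)
    obtain ⟨c', hc'⟩ := hcol.exists_linked (p (j - 1)) a
    have : c' = c1 := by
      rcases h.cut_mid hc' (show j - 2 < j - 1 by omega) (by omega)
        ⟨j - 1, by omega, by omega, rfl⟩ (fun k h1 h2 => hap k (by omega)) with hh | hh
      · exact color_unique hh.1 (hE _ (by omega) (by omega))
      · exact color_unique hh.1 (hE _ (by omega) (by omega))
    subst this
    exact (hreach (j - 1) (by omega)).trans hc'.reachable)
  have hfar : ∀ b, 3 ≤ b → b ≤ j → col (Sum.inl (p b)) = c1 := by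
    intro b hb hbj
    obtain ⟨b, rfl⟩ : ∃ b', b = b' + 1 := ⟨b - 1, by omega⟩
    exact (hp1 b (by omega) (by omega) (by omega)).2.2 (by omega)
  -- If this link starts with the edge to `p 0`, its color is not `c1` and has an edge and a vertex,
  -- wasting one more color. Otherwise it passes `p 2`, which therefore has color `c1`.
  obtain ⟨α, hα⟩ := hcol.exists_linked (p 1) (p j)
  rcases h.cut_mid hα (show 0 < 1 by omega) (by omega) ⟨1, by omega, by omega, rfl⟩
    (fun k h1 h2 => h.ne_of_ne (by omega) (by omega) (by omega)) with hh | hh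
  · have hαc : α ≠ c1 := fun he => hq (he ▸ hh.1)
    have hpα : col (Sum.inl (p 0)) = α :=
      hh.2.2.resolve_left (h.ne_of_ne (by omega) (by omega) (by omega))
    have hcard := h.card_vertexClass' (c := c1) (I := Finset.Icc 3 j)
      (fun b hb => (Finset.mem_Icc.1 hb).2)
      (fun b hb => hfar b (Finset.mem_Icc.1 hb).1 (Finset.mem_Icc.1 hb).2) hA1
    rw [Nat.card_Icc] at hcard
    have h1 : 0 < (col.colorGraph α).edgeFinset.card :=
      Finset.card_pos.2 ⟨s(p 0, p 1), by simpa using hh.1⟩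
    have h2 : 0 < (col.vertexClass α).card :=
      Finset.card_pos.2 ⟨p 0, by rwa [mem_vertexClass]⟩
    have := col.numColors_add_sum_le (fun c' => if c' = c1 then A.card + 2 * j - 2 else 1)
      {c1, α} (by
        intro c' hc'
        rw [Finset.mem_insert, Finset.mem_singleton] at hc'
        right
        rcases hc' with rfl | rfl
        · simp only [if_true]
          omega
        · simp only [if_neg hαc]
          omega)
    rw [Finset.sum_pair hαc.symm] at this
    simp only [if_true, if_neg hαc] at this
    omega
  · have hαc := color_unique hh.1 (hE 1 (by omega) (by omega))
    subst hαc
    have hp2 := hh.2.2.resolve_left (h.ne_of_ne (by omega) (by omega) (by omega))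
    have := h.card_vertexClass' (c := α) (I := Finset.Icc 2 j)
      (fun b hb => (Finset.mem_Icc.1 hb).2)
      (fun b hb => by
        rw [Finset.mem_Icc] at hb
        rcases Nat.lt_or_ge b 3 with hlt | hge
        · rw [show b = 1 + 1 by omega]
          exact hp2
        · exact hfar b hge hb.2) hA1
    rw [Nat.card_Icc] at this
    refine h.numColors_le_of_class (c := α) ?_
    omega

/-- Because of the change at `p 2`, the detour from `p 1` to `p 3` has color `x`, as has every link
from `p 1` into `A`. This gives |A| + 2 edges, and the vertices are `p 0` and one in `A`. -/
theorem card_class_of_three (h : IsTheta G 3 p A) (hcol : col.IsTMC) {x y z : ℕ}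
    (hx : (col.colorGraph x).Adj (p 0) (p 1)) (hy : (col.colorGraph y).Adj (p 1) (p 2))
    (hz : (col.colorGraph z).Adj (p 2) (p 3)) (hyz : y ≠ z) :
    A.card + 4 ≤ (col.colorGraph x).edgeFinset.card + (col.vertexClass x).card := by
  obtain ⟨c1, hl1, hp1, hA1⟩ := h.of_change hcol (i := 1) (by omega) (fun c' hc' => by
    exact hyz ((color_unique hy hc'.1).trans (color_unique hc'.2 hz)))
  have hc1 := color_unique (hp1 0 (by omega) (by omega) (by omega)).1 hx
  subst hc1
  have hv := h.card_vertexClass' (c := c1) (I := {0}) (by simp) (fun b hb => by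
    rw [Finset.mem_singleton] at hb
    subst hb
    exact (hp1 0 (by omega) (by omega) (by omega)).2.1 (by omega)) hA1
  rw [Finset.card_singleton] at hv
  have he := card_reachable_le (col.colorGraph c1) (p 1) (A ∪ ({0, 1, 3} : Finset ℕ).image p) (by
    intro v hv
    rcases Finset.mem_union.1 hv with ha | hv
    · have hap : ∀ i ≤ 3, v ≠ p i := fun i hi he => h.notMem i hi (he ▸ ha)
      obtain ⟨c', hc'⟩ := hcol.exists_linked (p 1) v
      have : c' = c1 := by
        rcases h.cut_mid hc' (show 0 < 1 by omega) (by omega)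
          ⟨1, by omega, by omega, rfl⟩ (fun k h1 h2 => hap k (by omega)) with hh | hh
        · exact color_unique hh.1 hx
        · rcases h.cut_mid hc' (show 0 < 2 by omega) (by omega)
            ⟨1, by omega, by omega, rfl⟩ (fun k h1 h2 => hap k (by omega)) with hg | hg
          · exact color_unique hg.1 hx
          · exact absurd ((color_unique hy hh.1).trans (color_unique hg.1 hz)) hyz
      subst this
      exact hc'.reachable
    · simp only [Finset.image_insert, Finset.image_singleton, Finset.mem_insert,
        Finset.mem_singleton] at hv
      rcases hv with rfl | rfl | rfl
      · exact hx.symm.reachable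
      · exact Reachable.refl _
      · exact hl1.reachable)
  rw [Finset.card_union_of_disjoint, Finset.card_image_of_injOn] at he
  · simp only [Finset.mem_insert, Finset.mem_singleton, OfNat.zero_ne_ofNat, OfNat.one_ne_ofNat,
      zero_ne_one, or_self, not_false_eq_true, Finset.card_insert_of_notMem,
      Finset.card_singleton] at he
    omega
  · intro a ha b hb hab
    refine h.inj a ?_ b ?_ hab
    · simp at ha; omega
    · simp at hb; omega
  · rw [Finset.disjoint_left]
    intro v hv hv'
    obtain ⟨a, ha, rfl⟩ := Finset.mem_image.1 hv'
    exact h.notMem a (by simp at ha; omega) hv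

/-- At a change, all path edges other than the two involved have one color. Hence the path is
monochromatic, or has one exceptional edge, or has three edges of different colors. -/
theorem numColors_le (h : IsTheta G j p A) (hcol : col.IsTMC) :
    col.numColors + (A.card + 2 * j - 1) ≤ G.edgeFinset.card + Fintype.card V := by
  have h3 := h.three_le
  have hg : ∀ i < j, ∃ c, (col.colorGraph c).Adj (p i) (p (i + 1)) :=
    fun i hi => ⟨_, h.adj i hi, rfl⟩
  choose! g hg using hg
  have hne : ∀ i < j, ∀ c, g i ≠ c → ¬ (col.colorGraph c).Adj (p i) (p (i + 1)) :=
    fun i hi c hc hadj => hc (color_unique (hg i hi) hadj)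
  by_cases hconst : ∀ i, i + 1 < j → g i = g (i + 1)
  · refine h.numColors_le_of_const hcol (c := g 0) ?_
    intro i hi
    have : g i = g 0 := by
      induction i with
      | zero => rfl
      | succ i ih => rw [← hconst i hi, ih (by omega)]
    rw [← this]
    exact hg i hi
  push Not at hconst
  obtain ⟨i, hij, hi⟩ := hconst
  have hchange : ∀ i, i + 1 < j → g i ≠ g (i + 1) → ∃ c, ∀ b < j, b ≠ i → b ≠ i + 1 → g b = c := by
    intro i hij hi
    obtain ⟨c, -, hp, -⟩ := h.of_change hcol hij (fun c hc =>
      hi ((color_unique (hg i (by omega)) hc.1).trans (color_unique hc.2 (hg (i + 1) hij))))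
    exact ⟨c, fun b hb h1 h2 => color_unique (hg b hb) (hp b hb h1 h2).1⟩
  obtain ⟨c, hc⟩ := hchange i hij hi
  have hodd : ∀ q < j, g q ≠ c → (∀ b < j, b ≠ q → g b = c) →
      col.numColors + (A.card + 2 * j - 1) ≤ G.edgeFinset.card + Fintype.card V := by
    intro q hqj hq hb
    rcases Nat.eq_zero_or_pos q with rfl | hq0
    · exact h.numColors_le_of_odd_first hcol (c := c)
        (fun b hbj hb0 => hb b hbj (by omega) ▸ hg b hbj) (hne 0 hqj c hq)
    rcases Nat.lt_or_ge (q + 1) j with hlt | hge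
    · exact h.numColors_le_of_odd_inner hcol hq0 hlt
        (fun b hbj hb0 => hb b hbj hb0 ▸ hg b hbj) (hne q hqj c hq)
    · obtain rfl : j = q + 1 := by omega
      refine h.reflect.numColors_le_of_odd_first hcol (c := c) ?_ ?_
      · intro b hbj hb0
        have := hg (q - b) (by omega)
        rw [hb (q - b) (by omega) (by omega)] at this
        rw [show q + 1 - b = q - b + 1 by omega, show q + 1 - (b + 1) = q - b by omega]
        exact this.symm
      · intro hadj
        exact hne q hqj c hq hadj.symm
  by_cases hic : g i = c
  · refine hodd (i + 1) hij (fun h => hi (hic.trans h.symm)) fun b hb hbi => ?_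
    by_cases hbi' : b = i
    · rwa [hbi']
    · exact hc b hb hbi' hbi
  by_cases hic' : g (i + 1) = c
  · refine hodd i (by omega) hic fun b hb hbi => ?_
    by_cases hbi' : b = i + 1
    · rwa [hbi']
    · exact hc b hb hbi hbi'
  -- The two edges at the change both differ from `c`, so there is a second change next to the
  -- first. Comparing the two statements of `hchange` leaves no room for a fourth edge.
  have hthree : j = 3 ∧ g 0 ≠ g 1 ∧ g 1 ≠ g 2 := by
    rcases Nat.eq_zero_or_pos i with rfl | hi0
    · have h2 := hc 2 (by omega) (by omega) (by omega)
      obtain ⟨c', hc'⟩ := hchange 1 (by omega) (fun h => hic' (h.trans h2))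
      refine ⟨?_, hi, fun h => hic' (h.trans h2)⟩
      by_contra hj
      have h4 := hc 3 (by omega) (by omega) (by omega)
      rw [hc' 3 (by omega) (by omega) (by omega)] at h4
      exact hic ((hc' 0 (by omega) (by omega) (by omega)).trans h4)
    · obtain ⟨i, rfl⟩ : ∃ i', i = i' + 1 := ⟨i - 1, by omega⟩
      have h2 := hc i (by omega) (by omega) (by omega)
      obtain ⟨c', hc'⟩ := hchange i (by omega) (fun h => hic (h.symm.trans h2))
      have h4 := hc' (i + 2) hij (by omega) (by omega)
      have hno : ∀ b < j, b = i ∨ b = i + 1 ∨ b = i + 2 := by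
        intro b hb
        by_contra hcon
        have h5 := hc b hb (by omega) (by omega)
        rw [hc' b hb (by omega) (by omega)] at h5
        exact hic' (h4.trans h5)
      have h6 := hno 0 (by omega)
      obtain rfl : i = 0 := by omega
      have h7 := hno (j - 1) (by omega)
      exact ⟨by omega, fun h => hic (h.symm.trans h2), hi⟩
  obtain ⟨rfl, h01, h12⟩ := hthree
  have h02 : g 0 ≠ g 2 := by
    intro h02
    have hi2 : i = 0 ∨ i = 1 := by omega
    rcases hi2 with rfl | rfl
    · exact hic (h02.trans (hc 2 (by omega) (by omega) (by omega)))
    · exact hic' (h02.symm.trans (hc 0 (by omega) (by omega) (by omega)))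
  have hx := h.card_class_of_three hcol (hg 0 (by omega)) (hg 1 (by omega)) (hg 2 (by omega)) h12
  have hz := h.reflect.card_class_of_three hcol (hg 2 (by omega)).symm (hg 1 (by omega)).symm
    (hg 0 (by omega)).symm h01.symm
  -- Two classes waste 2|A| + 6 colors in total, more than the |A| + 5 needed for j = 3.
  have := col.numColors_add_sum_le (fun _ => A.card + 3) {g 0, g 2} (by
    intro c' hc'
    rw [Finset.mem_insert, Finset.mem_singleton] at hc'
    right
    rcases hc' with rfl | rfl <;> omega)
  rw [Finset.sum_pair h02] at this
  omega

theorem tmc_add_le (h : IsTheta G j p A) : G.tmc + j ≤ G.edgeFinset.card + 2 := by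
  have h3 := h.three_le
  have hcard := h.card_eq
  have hm : j ≤ G.edgeFinset.card := by
    have : (Finset.range j).card ≤ G.edgeFinset.card := by
      refine Finset.card_le_card_of_injOn (fun i => s(p i, p (i + 1))) ?_ ?_
      · intro i hi
        simpa using h.adj i (by simpa using hi)
      · intro a ha b hb hab
        simp only [Finset.coe_range, Set.mem_Iio] at ha hb
        rcases Sym2.eq_iff.1 hab with ⟨h1, -⟩ | ⟨h1, h2⟩
        · exact h.inj a (by omega) b (by omega) h1
        · have := h.inj a (by omega) (b + 1) (by omega) h1
          have := h.inj (a + 1) (by omega) b (by omega) h2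
          omega
    simpa using this
  suffices hh : G.tmc ≤ G.edgeFinset.card + 2 - j by omega
  refine tmc_le_of_forall fun col hcol => ?_
  have := h.numColors_le hcol
  omega

end IsTheta

end Theta

/-! ### Colorings from connected dominating sets -/

section LowerBound

open scoped Classical

variable {V : Type*} {G : SimpleGraph V}

/-- Nonempty vertex sets inducing a connected subgraph, generated by adding neighbours. -/
inductive Grown (G : SimpleGraph V) : Finset V → Prop
  | single (v : V) : Grown G {v}
  | step {D : Finset V} {x d : V} : Grown G D → d ∈ D → G.Adj d x → Grown G (insert x D)

theorem Grown.nonempty {D : Finset V} (h : Grown G D) : D.Nonempty := by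
  cases h with
  | single v => exact Finset.singleton_nonempty v
  | step _ _ _ => exact Finset.insert_nonempty _ _

/-- A grown set carries a tree. -/
theorem Grown.exists_tree {D : Finset V} (h : Grown G D) :
    ∃ E : Finset (Sym2 V), E.card + 1 ≤ D.card ∧ ∀ u ∈ D, ∀ v ∈ D, ∃ p : G.Walk u v,
      (∀ e ∈ p.edges, e ∈ E) ∧ ∀ w ∈ p.support, w ∈ D := by
  induction h with
  | single v =>
    refine ⟨∅, by simp, fun u hu w hw => ?_⟩
    rw [Finset.mem_singleton] at hu hw
    subst hu hw
    exact ⟨Walk.nil, by simp, by simp⟩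
  | @step D x d hD hd hadj ih =>
    obtain ⟨E, hE, hp⟩ := ih
    by_cases hx : x ∈ D
    · rw [Finset.insert_eq_of_mem hx]
      exact ⟨E, hE, hp⟩
    refine ⟨insert s(d, x) E, ?_, ?_⟩
    · rw [Finset.card_insert_of_notMem hx]
      have := Finset.card_insert_le s(d, x) E
      omega
    · have hone : ∀ u ∈ D, ∃ p : G.Walk u x, (∀ e ∈ p.edges, e ∈ insert s(d, x) E) ∧
          ∀ w ∈ p.support, w ∈ insert x D := by
        intro u hu
        obtain ⟨p, h1, h2⟩ := hp u hu d hd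
        refine ⟨p.concat hadj, ?_, ?_⟩
        · intro e he
          rw [Walk.edges_concat, List.concat_eq_append, List.mem_append, List.mem_singleton] at he
          rcases he with he | rfl
          · exact Finset.mem_insert_of_mem (h1 e he)
          · exact Finset.mem_insert_self _ _
        · intro w hw
          rw [Walk.support_concat, List.mem_append, List.mem_singleton] at hw
          rcases hw with hw | rfl
          · exact Finset.mem_insert_of_mem (h2 w hw)
          · exact Finset.mem_insert_self _ _
      intro u hu v hv
      rw [Finset.mem_insert] at hu hv
      rcases hu with hu | hu
      · subst hu
        rcases hv with rfl | hv
        · exact ⟨Walk.nil, by simp, by simp⟩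
        · obtain ⟨p, h1, h2⟩ := hone v hv
          exact ⟨p.reverse, by simpa using h1, by simpa using h2⟩
      · rcases hv with hv | hv
        · subst hv
          exact hone u hu
        · obtain ⟨p, h1, h2⟩ := hp u hu v hv
          exact ⟨p, fun e he => Finset.mem_insert_of_mem (h1 e he),
            fun w hw => Finset.mem_insert_of_mem (h2 w hw)⟩

/-- The neighbours of `x` in `S`. -/
noncomputable def nbrsIn (G : SimpleGraph V) (x : V) (S : Finset V) : Finset V :=
  S.filter fun v => G.Adj x v

theorem mem_nbrsIn {x v : V} {S : Finset V} : v ∈ G.nbrsIn x S ↔ v ∈ S ∧ G.Adj x v := by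
  simp [nbrsIn]

theorem nbrsIn_subset {x : V} {S : Finset V} : G.nbrsIn x S ⊆ S := Finset.filter_subset _ _

variable [Fintype V]

theorem numColors_le_tmc {col : G.TotalColoring} (h : col.IsTMC) : col.numColors ≤ G.tmc := by
  refine le_csSup ⟨Fintype.card (V ⊕ G.edgeSet), ?_⟩ ⟨col, h, rfl⟩
  rintro _ ⟨col', -, rfl⟩
  rw [TotalColoring.numColors_eq]
  exact Finset.card_image_le

/-- If all nonadjacent pairs are joined through the edges of `E` and the vertices of `D`, giving
these one common color and all the rest different colors is a TMC-coloring. -/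
theorem card_add_one_le_tmc_add (E : Finset (Sym2 V)) (D : Finset V) (hD : D.Nonempty)
    (h : ∀ u v, u ≠ v → ¬ G.Adj u v → ∃ p : G.Walk u v, (∀ e ∈ p.edges, e ∈ E) ∧
      ∀ w ∈ p.support, w ≠ u → w ≠ v → w ∈ D) :
    G.edgeFinset.card + Fintype.card V + 1 ≤ G.tmc + (E.card + D.card) := by
  set B : Finset (V ⊕ G.edgeSet) :=
    Finset.univ.filter (fun x => Sum.elim (fun v => v ∈ D) (fun e => e.1 ∈ E) x) with hB
  obtain ⟨φ⟩ : Nonempty (V ⊕ G.edgeSet ≃ Fin (Fintype.card (V ⊕ G.edgeSet))) :=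
    ⟨Fintype.equivFin _⟩
  set col : G.TotalColoring := fun x => if x ∈ B then 0 else (φ x).1 + 1 with hcol
  have htmc : col.IsTMC := by
    intro u v
    by_cases huv : u = v
    · subst huv
      exact ⟨Walk.nil, Walk.IsPath.nil, 0, by simp, by simp⟩
    by_cases hadj : G.Adj u v
    · refine ⟨hadj.toWalk, Walk.IsPath.of_adj hadj, col (Sum.inr ⟨s(u, v), hadj⟩), ?_, ?_⟩
      · intro e he
        simp only [Adj.toWalk, Walk.edges_cons, Walk.edges_nil, List.mem_singleton] at he
        subst he
        rfl
      · intro w hw h1 h2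
        simp [Adj.toWalk] at hw
        tauto
    · obtain ⟨p, hp1, hp2⟩ := h u v huv hadj
      refine ⟨p.bypass, p.bypass_isPath, 0, ?_, ?_⟩
      · intro e he
        have : e ∈ E := hp1 e (p.edges_bypass_subset_edges he)
        simp [hcol, hB, this]
      · intro w hw h1 h2
        have : w ∈ D := hp2 w (p.support_bypass_subset_support hw) h1 h2
        simp [hcol, hB, this]
  have hBcard : B.card ≤ E.card + D.card := by
    have h1 : B ⊆ D.map ⟨Sum.inl, Sum.inl_injective⟩ ∪
        (Finset.univ.filter fun e : G.edgeSet => e.1 ∈ E).map ⟨Sum.inr, Sum.inr_injective⟩ := by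
      rintro (x | x) hx
      · simpa [hB] using hx
      · simpa [hB] using hx
    have h2 := (Finset.card_le_card h1).trans (Finset.card_union_le _ _)
    rw [Finset.card_map, Finset.card_map] at h2
    have h3 : (Finset.univ.filter fun e : G.edgeSet => e.1 ∈ E).card ≤ E.card :=
      Finset.card_le_card_of_injOn (fun e => e.1) (fun e he => by simpa using he)
        (fun _ _ _ _ h => Subtype.ext h)
    omega
  have hcount : (Finset.univ \ B).card + 1 ≤ (Finset.univ.image col).card := by
    have hinj : Set.InjOn (fun x => (φ x).1 + 1) (Finset.univ \ B : Finset (V ⊕ G.edgeSet)) := by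
      intro x _ y _ hxy
      exact φ.injective (Fin.ext (Nat.succ_injective hxy))
    rw [← Finset.card_image_of_injOn hinj, ← Finset.card_insert_of_notMem (a := 0) (by simp)]
    refine Finset.card_le_card ?_
    intro c hc
    rcases Finset.mem_insert.1 hc with rfl | hc
    · obtain ⟨d, hd⟩ := hD
      exact Finset.mem_image.2 ⟨Sum.inl d, Finset.mem_univ _, by simp [hcol, hB, hd]⟩
    · obtain ⟨x, hx, rfl⟩ := Finset.mem_image.1 hc
      rw [Finset.mem_sdiff] at hx
      exact Finset.mem_image.2 ⟨x, Finset.mem_univ _, by simp [hcol, hx.2]⟩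
  have h1 := numColors_le_tmc htmc
  rw [TotalColoring.numColors_eq] at h1
  have h2 : (Finset.univ \ B).card + B.card = Fintype.card V + G.edgeFinset.card := by
    rw [Finset.card_sdiff_add_card_eq_card (Finset.subset_univ _), Finset.card_univ,
      Fintype.card_sum, edgeFinset_card]
  omega

/-- A connected set `D` dominating the vertices of `X`, which meets all nonadjacent pairs outside
`D`, yields a TMC-coloring. -/
theorem Grown.card_le_tmc_add {D X : Finset V} (h : Grown G D)
    (hX : ∀ x ∈ X, ∃ d ∈ D, G.Adj d x)
    (hpair : ∀ u v, u ≠ v → ¬ G.Adj u v → (u ∈ D ∨ u ∈ X) ∧ (v ∈ D ∨ v ∈ X)) :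
    G.edgeFinset.card + Fintype.card V + 2 ≤ G.tmc + (2 * D.card + X.card) := by
  obtain ⟨E, hE, hp⟩ := h.exists_tree
  choose! d hd hadj using hX
  have key : ∀ u, (u ∈ D ∨ u ∈ X) → ∃ u' ∈ D, ∃ p : G.Walk u u',
      (∀ e ∈ p.edges, e ∈ E ∪ X.image fun x => s(d x, x)) ∧ ∀ w ∈ p.support, w ≠ u → w ∈ D := by
    intro u hu
    rcases hu with hu | hu
    · exact ⟨u, hu, Walk.nil, by simp, by simp⟩
    · refine ⟨d u, hd u hu, (hadj u hu).symm.toWalk, ?_, ?_⟩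
      · intro e he
        simp only [Adj.toWalk, Walk.edges_cons, Walk.edges_nil, List.mem_singleton] at he
        subst he
        rw [Sym2.eq_swap]
        exact Finset.mem_union_right _ (Finset.mem_image_of_mem _ hu)
      · intro w hw hwu
        simp only [Adj.toWalk, Walk.support_cons, Walk.support_nil, List.mem_cons,
          List.not_mem_nil, or_false] at hw
        rcases hw with rfl | rfl
        · exact absurd rfl hwu
        · exact hd u hu
  have hmain := card_add_one_le_tmc_add (G := G) (E ∪ X.image fun x => s(d x, x)) D h.nonempty (by
    intro u v huv hn
    obtain ⟨hu, hv⟩ := hpair u v huv hn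
    obtain ⟨u', hu', p, hp1, hp2⟩ := key u hu
    obtain ⟨v', hv', q, hq1, hq2⟩ := key v hv
    obtain ⟨r, hr1, hr2⟩ := hp u' hu' v' hv'
    refine ⟨p.append (r.append q.reverse), ?_, ?_⟩
    · intro e he
      simp only [Walk.edges_append, Walk.edges_reverse, List.mem_append, List.mem_reverse] at he
      rcases he with he | he | he
      · exact hp1 e he
      · exact Finset.mem_union_left _ (hr1 e he)
      · exact hq1 e he
    · intro w hw h1 h2
      simp only [Walk.mem_support_append_iff, Walk.support_reverse, List.mem_reverse] at hw
      rcases hw with hw | hw | hw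
      · exact hp2 w hw h1
      · exact hr2 w hw
      · exact hq2 w hw h2)
  have h1 := Finset.card_union_le E (X.image fun x => s(d x, x))
  have h2 : (X.image fun x => s(d x, x)).card ≤ X.card := Finset.card_image_le
  omega

/-- The vertices outside `D` with a neighbour in `D`. -/
noncomputable def bdry (G : SimpleGraph V) (D : Finset V) : Finset V :=
  Finset.univ.filter fun v => v ∉ D ∧ ∃ d ∈ D, G.Adj d v

/-- The vertices outside `D` without a neighbour in `D`. -/
noncomputable def outer (G : SimpleGraph V) (D : Finset V) : Finset V :=
  Finset.univ.filter fun v => v ∉ D ∧ ∀ d ∈ D, ¬ G.Adj d v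

theorem mem_bdry {D : Finset V} {v : V} : v ∈ G.bdry D ↔ v ∉ D ∧ ∃ d ∈ D, G.Adj d v := by
  simp [bdry]

theorem mem_outer {D : Finset V} {v : V} : v ∈ G.outer D ↔ v ∉ D ∧ ∀ d ∈ D, ¬ G.Adj d v := by
  simp [outer]

theorem disjoint_bdry_outer (D : Finset V) : Disjoint (G.bdry D) (G.outer D) := by
  rw [Finset.disjoint_left]
  intro v h1 h2
  obtain ⟨d, hd, hadj⟩ := (mem_bdry.1 h1).2
  exact (mem_outer.1 h2).2 d hd hadj

theorem union_bdry_outer (D : Finset V) : D ∪ (G.bdry D ∪ G.outer D) = Finset.univ := by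
  ext v
  simp only [Finset.mem_union, mem_bdry, mem_outer, Finset.mem_univ, iff_true]
  by_cases hv : v ∈ D
  · exact Or.inl hv
  · by_cases h : ∃ d ∈ D, G.Adj d v
    · exact Or.inr (Or.inl ⟨hv, h⟩)
    · push Not at h
      exact Or.inr (Or.inr ⟨hv, h⟩)

theorem disjoint_bdry_union_outer (D : Finset V) : Disjoint D (G.bdry D ∪ G.outer D) := by
  rw [Finset.disjoint_left]
  intro v h1 h2
  rcases Finset.mem_union.1 h2 with h2 | h2
  · exact (mem_bdry.1 h2).1 h1
  · exact (mem_outer.1 h2).1 h1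

theorem card_add_bdry_add_outer (D : Finset V) :
    D.card + (G.bdry D).card + (G.outer D).card = Fintype.card V := by
  rw [← Finset.card_univ, ← union_bdry_outer (G := G) D,
    Finset.card_union_of_disjoint (disjoint_bdry_union_outer D),
    Finset.card_union_of_disjoint (disjoint_bdry_outer D), add_assoc]

theorem bdry_insert {D : Finset V} {x : V} (hx : x ∈ G.bdry D) :
    G.bdry (insert x D) = (G.bdry D).erase x ∪ G.nbrsIn x (G.outer D) := by
  obtain ⟨hxD, -⟩ := mem_bdry.1 hx
  ext v
  simp only [mem_bdry, Finset.mem_insert, not_or, Finset.mem_union, Finset.mem_erase, mem_nbrsIn,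
    mem_outer, exists_eq_or_imp]
  constructor
  · rintro ⟨⟨h1, h2⟩, h3⟩
    by_cases h4 : ∃ d ∈ D, G.Adj d v
    · exact Or.inl ⟨h1, h2, h4⟩
    · refine Or.inr ⟨⟨h2, fun d hd hadj => h4 ⟨d, hd, hadj⟩⟩, h3.resolve_right h4⟩
  · rintro (⟨h1, h2, h3⟩ | ⟨⟨h1, h2⟩, h3⟩)
    · exact ⟨⟨h1, h2⟩, Or.inr h3⟩
    · exact ⟨⟨h3.ne', h1⟩, Or.inl h3⟩

theorem outer_insert {D : Finset V} {x : V} (hx : x ∈ G.bdry D) :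
    G.outer (insert x D) = G.outer D \ G.nbrsIn x (G.outer D) := by
  have hxo : x ∉ G.outer D := Finset.disjoint_left.1 (disjoint_bdry_outer D) hx
  ext v
  simp only [mem_outer, Finset.mem_insert, not_or, forall_eq_or_imp, Finset.mem_sdiff, mem_nbrsIn,
    not_and]
  constructor
  · rintro ⟨⟨h1, h2⟩, h3, h4⟩
    exact ⟨⟨h2, h4⟩, fun _ => h3⟩
  · rintro ⟨⟨h1, h2⟩, h3⟩
    refine ⟨⟨?_, h1⟩, h3 ⟨h1, h2⟩, h2⟩
    rintro rfl
    exact hxo (mem_outer.2 ⟨h1, h2⟩)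

/-- Absorbing a neighbor `x` trades it for its outer neighbors. This is the bookkeeping behind all
leaf counts below. -/
theorem card_bdry_insert {D : Finset V} {x : V} (hx : x ∈ G.bdry D) :
    (G.bdry (insert x D)).card + 1 = (G.bdry D).card + (G.nbrsIn x (G.outer D)).card := by
  rw [bdry_insert hx, Finset.card_union_of_disjoint, Finset.card_erase_of_mem hx]
  · have := Finset.card_pos.2 ⟨x, hx⟩
    omega
  · exact (disjoint_bdry_outer D).mono (Finset.erase_subset _ _) nbrsIn_subset

theorem card_outer_insert {D : Finset V} {x : V} (hx : x ∈ G.bdry D) :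
    (G.outer (insert x D)).card + (G.nbrsIn x (G.outer D)).card = (G.outer D).card := by
  rw [outer_insert hx, Finset.card_sdiff_add_card_eq_card nbrsIn_subset]

theorem Grown.insert_bdry {D : Finset V} (h : Grown G D) {x : V} (hx : x ∈ G.bdry D) :
    Grown G (insert x D) := by
  obtain ⟨-, d, hd, hadj⟩ := mem_bdry.1 hx
  exact h.step hd hadj

theorem exists_bdry_nbrsIn_nonempty (hG : G.Connected) {D : Finset V} (hD : D.Nonempty)
    (hO : (G.outer D).Nonempty) : ∃ x ∈ G.bdry D, (G.nbrsIn x (G.outer D)).Nonempty := by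
  obtain ⟨d, hd⟩ := hD
  obtain ⟨o, ho⟩ := hO
  obtain ⟨p⟩ := hG.preconnected d o
  obtain ⟨e, -, he1, he2⟩ := p.exists_boundary_dart {v | v ∉ G.outer D}
    (fun h => (mem_outer.1 h).1 hd) (by simpa using ho)
  simp only [Set.mem_ofPred_eq, not_not] at he1 he2
  have hout : e.snd ∈ G.outer D := he2
  refine ⟨e.fst, ?_, e.snd, mem_nbrsIn.2 ⟨hout, e.adj⟩⟩
  have hu := Finset.mem_univ e.fst
  rw [← union_bdry_outer (G := G) D, Finset.mem_union, Finset.mem_union] at hu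
  rcases hu with hu | hu | hu
  · exact absurd e.adj ((mem_outer.1 hout).2 _ hu)
  · exact hu
  · exact absurd hu he1

/-- A connected set extends to a connected dominating set with as many vertices outside as it has
neighbours. -/
theorem Grown.exists_dominating (hG : G.Connected) {D : Finset V} (h : Grown G D) :
    ∃ D', Grown G D' ∧ G.outer D' = ∅ ∧ D'.card + (G.bdry D).card ≤ Fintype.card V := by
  induction hn : (G.outer D).card using Nat.strong_induction_on generalizing D with
  | _ n ih =>
    rcases (G.outer D).eq_empty_or_nonempty with h0 | h0
    · refine ⟨D, h, h0, ?_⟩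
      have := card_add_bdry_add_outer (G := G) D
      omega
    · obtain ⟨x, hx, hne⟩ := exists_bdry_nbrsIn_nonempty hG h.nonempty h0
      have h1 := card_bdry_insert hx
      have h2 := card_outer_insert hx
      have h3 := Finset.card_pos.2 hne
      obtain ⟨D', hD', ho, hc⟩ := ih _ (by omega) (h.insert_bdry hx) rfl
      exact ⟨D', hD', ho, by omega⟩

/-- A connected set with `t` neighbours yields a TMC-coloring with `m - n + 2 + t` colors. -/
theorem Grown.le_tmc (hG : G.Connected) {D : Finset V} (h : Grown G D) :
    G.edgeFinset.card + 2 + (G.bdry D).card ≤ G.tmc + Fintype.card V := by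
  obtain ⟨D', hD', ho, hc⟩ := h.exists_dominating hG
  have hmem : ∀ u, u ∈ D' ∨ u ∈ G.bdry D' := by
    intro u
    have hu := Finset.mem_univ u
    rw [← union_bdry_outer (G := G) D', ho, Finset.union_empty, Finset.mem_union] at hu
    exact hu
  have h1 := hD'.card_le_tmc_add (X := G.bdry D') (fun x hx => (mem_bdry.1 hx).2)
    (fun u v _ _ => ⟨hmem u, hmem v⟩)
  have h2 := card_add_bdry_add_outer (G := G) D'
  rw [ho, Finset.card_empty] at h2
  omega

end LowerBound

/-! ### Counting ordered adjacent pairs -/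

section Links

open scoped Classical

variable {V : Type*} {G : SimpleGraph V}

/-- The number of adjacent pairs in `A × B`. -/
noncomputable def links (G : SimpleGraph V) (A B : Finset V) : ℕ :=
  ∑ x ∈ A, (G.nbrsIn x B).card

theorem card_nbrsIn (x : V) (B : Finset V) :
    (G.nbrsIn x B).card = ∑ y ∈ B, if G.Adj x y then 1 else 0 := by
  rw [nbrsIn, Finset.card_filter]

theorem links_comm (A B : Finset V) : G.links A B = G.links B A := by
  simp only [links, card_nbrsIn]
  rw [Finset.sum_comm]
  simp only [G.adj_comm]

theorem links_union_left {A A' : Finset V} (B : Finset V) (h : Disjoint A A') :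
    G.links (A ∪ A') B = G.links A B + G.links A' B := by
  rw [links, Finset.sum_union h]
  rfl

theorem links_union_right (A : Finset V) {B B' : Finset V} (h : Disjoint B B') :
    G.links A (B ∪ B') = G.links A B + G.links A B' := by
  rw [links_comm, links_union_left _ h, links_comm B, links_comm B']

theorem links_le_mul {A B : Finset V} {k : ℕ} (h : ∀ x ∈ A, (G.nbrsIn x B).card ≤ k) :
    G.links A B ≤ A.card * k := by
  rw [← smul_eq_mul]
  exact Finset.sum_le_card_nsmul _ _ _ h

theorem links_singleton_left (x : V) (B : Finset V) : G.links {x} B = (G.nbrsIn x B).card := by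
  simp [links]

theorem links_empty_right (A : Finset V) : G.links A ∅ = 0 := by
  simp [links, nbrsIn]

theorem links_self_singleton (x : V) : G.links {x} {x} = 0 := by
  simp [links, nbrsIn, Finset.filter_singleton]

theorem nbrsIn_mono (x : V) {B B' : Finset V} (h : B ⊆ B') : G.nbrsIn x B ⊆ G.nbrsIn x B' :=
  Finset.filter_subset_filter _ h

theorem links_self_add_card_le (S : Finset V) : G.links S S + S.card ≤ S.card * S.card := by
  have h : ∀ x ∈ S, (G.nbrsIn x S).card + 1 ≤ S.card := by
    intro x hx
    rw [← Finset.card_insert_of_notMem (a := x) (by simp [nbrsIn])]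
    exact Finset.card_le_card (Finset.insert_subset hx nbrsIn_subset)
  have := Finset.sum_le_card_nsmul _ _ _ h
  rw [Finset.sum_add_distrib] at this
  simpa [links] using this

theorem links_split {O N : Finset V} (h : N ⊆ O) :
    G.links O O = G.links N N + 2 * G.links N (O \ N) + G.links (O \ N) (O \ N) := by
  have hd : Disjoint N (O \ N) := Finset.disjoint_sdiff
  conv_lhs => rw [← Finset.union_sdiff_of_subset h]
  rw [links_union_left _ hd, links_union_right _ hd, links_union_right _ hd,
    links_comm (O \ N) N]
  ring

variable [Fintype V]

theorem card_nbrsIn_univ (x : V) : (G.nbrsIn x Finset.univ).card = G.degree x := by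
  rw [← card_neighborFinset_eq_degree]
  congr 1
  ext y
  simp [nbrsIn]

theorem links_univ : G.links Finset.univ Finset.univ = 2 * G.edgeFinset.card := by
  rw [← sum_degrees_eq_twice_card_edges]
  exact Finset.sum_congr rfl fun x _ => card_nbrsIn_univ x

theorem links_le_of_degree_le {Δ : ℕ} (hΔ : ∀ x, G.degree x ≤ Δ) (A B : Finset V) :
    G.links A B ≤ A.card * Δ :=
  links_le_mul fun x _ => (Finset.card_le_card (nbrsIn_mono x (Finset.subset_univ _))).trans
    ((card_nbrsIn_univ x).trans_le (hΔ x))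

end Links

/-! ### The theorem of Ding, Johnson and Seymour -/

section Leaves

open scoped Classical

variable {V : Type*} [Fintype V] {G : SimpleGraph V} {T Δ : ℕ}

theorem Grown.card_nbrsIn_le (hT : ∀ D, Grown G D → (G.bdry D).card ≤ T) {D : Finset V}
    (h : Grown G D) {x : V} (hx : x ∈ G.bdry D) :
    (G.nbrsIn x (G.outer D)).card + (G.bdry D).card ≤ T + 1 := by
  rw [add_comm, ← card_bdry_insert hx]
  exact Nat.succ_le_succ (hT _ (h.insert_bdry hx))

/-- At the maximal boundary size every boundary vertex has at most one outer neighbor. Outer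
vertices are then absorbed one at a time, each having at most one neighbor among those still
outside. -/
theorem Grown.links_outer_le (hG : G.Connected) (hT : ∀ D, Grown G D → (G.bdry D).card ≤ T)
    {D : Finset V} (h : Grown G D) (hD : (G.bdry D).card = T) :
    G.outer D = ∅ ∨ G.links (G.outer D) (G.outer D) + 2 ≤ 2 * (G.outer D).card := by
  induction hn : (G.outer D).card using Nat.strong_induction_on generalizing D with
  | _ n ih =>
    rcases (G.outer D).eq_empty_or_nonempty with h0 | h0
    · exact Or.inl h0
    right
    obtain ⟨x, hx, hne⟩ := exists_bdry_nbrsIn_nonempty hG h.nonempty h0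
    have h1 := h.card_nbrsIn_le hT hx
    have h2 := card_bdry_insert hx
    have h3 := card_outer_insert hx
    have h4 := Finset.card_pos.2 hne
    have hone : (G.nbrsIn x (G.outer D)).card = 1 := by omega
    have hD' := h.insert_bdry hx
    obtain ⟨r, hr⟩ := Finset.card_eq_one.1 hone
    have hrb : r ∈ G.bdry (insert x D) := by
      rw [bdry_insert hx, hr]
      simp
    have hrn := hD'.card_nbrsIn_le hT hrb
    rw [links_split (nbrsIn_subset (x := x) (G := G)), ← outer_insert hx, hr, links_self_singleton,
      links_singleton_left]
    rcases ih _ (by omega) hD' (by omega) rfl with h5 | h5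
    · rw [h5, links_empty_right]
      simp only [nbrsIn, Finset.filter_empty, Finset.card_empty]
      omega
    · omega

/-- The edges meeting the vertices not yet reached, when `e + 1` further leaves can be gained. -/
theorem Grown.links_bdry_add_links_outer_le (hG : G.Connected)
    (hT : ∀ D, Grown G D → (G.bdry D).card ≤ T) (hΔ : ∀ x, G.degree x ≤ Δ) {D : Finset V}
    (h : Grown G D) {e : ℕ} (he : (G.bdry D).card + e + 1 = T) {B : Finset V}
    (hB : B ⊆ G.bdry D) :
    G.links B (G.outer D) + G.links (G.outer D) (G.outer D) ≤
      2 * (G.outer D).card + 2 * (e * Δ) + max (2 * B.card) (B.card + Δ) := by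
  induction hn : (G.outer D).card using Nat.strong_induction_on generalizing D e B with
  | _ n ih =>
  rcases (G.outer D).eq_empty_or_nonempty with h0 | h0
  · rw [h0, links_empty_right, links_empty_right]
    omega
  -- The first term pays when e = 0 and one leaf is gained, where each vertex of `B` may have two
  -- outer neighbors. The second pays in the remaining cases.
  set M := max (2 * B.card) (B.card + Δ) with hM
  have hM1 : 2 * B.card ≤ M := le_max_left _ _
  have hM2 : B.card + Δ ≤ M := le_max_right _ _
  by_cases hbig : ∃ x ∈ G.bdry D, 2 ≤ (G.nbrsIn x (G.outer D)).card
  · obtain ⟨x, hx, hν⟩ := hbig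
    have hle := h.card_nbrsIn_le hT hx
    have hcb := card_bdry_insert hx
    have hco := card_outer_insert hx
    have hD' := h.insert_bdry hx
    have hbi := bdry_insert hx
    have hoi := outer_insert hx
    set N := G.nbrsIn x (G.outer D) with hN
    set O := G.outer D with hO
    have hNO : N ⊆ O := nbrsIn_subset
    have hBO : Disjoint B O := (disjoint_bdry_outer D).mono_left hB
    have hsplit := links_split (G := G) hNO
    rw [← hoi] at hsplit
    set O' := G.outer (insert x D) with hO'
    have hunion : N ∪ O' = O := by rw [hoi]; exact Finset.union_sdiff_of_subset hNO
    have hNO' : Disjoint N O' := by rw [hoi]; exact Finset.disjoint_sdiff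
    have hxO' : G.nbrsIn x O' = ∅ := by
      ext y
      simp only [mem_nbrsIn, Finset.notMem_empty, iff_false, not_and]
      intro hy hadj
      rw [hoi, Finset.mem_sdiff, hN, mem_nbrsIn] at hy
      exact hy.2 ⟨hy.1, hadj⟩
    obtain ⟨μ, hμ⟩ : ∃ μ, N.card = μ + 1 := ⟨N.card - 1, by omega⟩
    -- For e = 0 the term `e * Δ` vanishes and cannot pay for the degrees in `N`, so the pairs are
    -- counted directly.
    by_cases hone : μ = 1 ∧ e = 0
    · obtain ⟨rfl, rfl⟩ := hone
      have hBl : G.links B O ≤ B.card * 2 := by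
        refine links_le_mul fun y hy => ?_
        have := h.card_nbrsIn_le hT (hB hy)
        rw [← hO] at this
        omega
      have hNN := links_self_add_card_le (G := G) N
      have hNl : G.links N O' ≤ N.card * 1 := by
        refine links_le_mul fun y hy => ?_
        have := hD'.card_nbrsIn_le hT (x := y) (by rw [hbi]; exact Finset.mem_union_right _ hy)
        rw [← hO'] at this
        omega
      rw [hμ] at hNN hNl
      rcases hD'.links_outer_le hG hT (by omega) with h5 | h5
      · rw [← hO'] at h5
        rw [h5, links_empty_right] at hsplit
        rw [links_empty_right] at hsplit
        omega
      · rw [← hO'] at h5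
        omega
    · set B' := B.erase x ∪ N with hB'
      have hB'sub : B' ⊆ G.bdry (insert x D) := by
        rw [hbi]
        exact Finset.union_subset_union (Finset.erase_subset_erase _ hB) le_rfl
      have hdBN : Disjoint (B.erase x) N := hBO.mono (Finset.erase_subset _ _) hNO
      have hB'l : G.links B' O' = G.links B O' + G.links N O' := by
        rw [hB', links_union_left _ hdBN]
        congr 1
        by_cases hxB : x ∈ B
        · conv_rhs => rw [← Finset.insert_erase hxB, Finset.insert_eq]
          rw [links_union_left _ (by simp), links_singleton_left, hxO']
          simp
        · rw [Finset.erase_eq_of_notMem hxB]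
      have hBO' : G.links B O = G.links B N + G.links B O' := by
        rw [← hunion, links_union_right _ hNO']
      -- The pairs lost in passing from `B` and `O` to `B'` and `O'` are covered by the degrees of
      -- the `μ + 1` vertices of `N`. If `x` is not in `B`, their edges to `x` are saved.
      have hextra : G.links B N + G.links N N + G.links N O' = G.links N (B ∪ O) := by
        rw [links_union_right _ hBO, ← hunion, links_union_right _ hNO', links_comm B N]
        ring
      have hcard : (B'.card = B.card + μ ∧
            G.links B N + G.links N N + G.links N O' ≤ (μ + 1) * Δ) ∨
          (B'.card = B.card + μ + 1 ∧
            G.links B N + G.links N N + G.links N O' + (μ + 1) ≤ (μ + 1) * Δ) := by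
        have hc' : B'.card = (B.erase x).card + N.card := Finset.card_union_of_disjoint hdBN
        by_cases hxB : x ∈ B
        · left
          have := Finset.card_erase_of_mem hxB
          have := Finset.card_pos.2 ⟨x, hxB⟩
          refine ⟨by omega, ?_⟩
          rw [hextra, ← hμ]
          exact links_le_of_degree_le hΔ _ _
        · right
          rw [Finset.erase_eq_of_notMem hxB] at hc'
          refine ⟨by omega, ?_⟩
          have hxN : G.links N {x} = N.card := by
            rw [links_comm, links_singleton_left]
            congr 1
            exact Finset.filter_true_of_mem fun y hy => (mem_nbrsIn.1 hy).2
          have hxd : Disjoint {x} (B ∪ O) := by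
            rw [Finset.disjoint_singleton_left, Finset.mem_union, not_or]
            exact ⟨hxB, Finset.disjoint_left.1 (disjoint_bdry_outer D) hx⟩
          have hl := links_le_of_degree_le hΔ N ({x} ∪ (B ∪ O))
          rw [links_union_right _ hxd, hxN, ← hextra, hμ] at hl
          omega
      have hexp : (μ + 1) * Δ = μ * Δ + Δ := by ring
      have hμ1 : Δ ≤ μ * Δ := Nat.le_mul_of_pos_left _ (by omega)
      rw [hexp] at hcard
      rcases Nat.lt_or_ge e μ with hlt | hge
      · obtain rfl : μ = e + 1 := by omega
        have h5 : G.links O' O' ≤ 2 * O'.card := by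
          rcases hD'.links_outer_le hG hT (by omega) with h5 | h5
          · rw [hO', h5, links_empty_right]
            omega
          · rw [← hO'] at h5
            omega
        have h6 : G.links B' O' ≤ B'.card * 1 := by
          refine links_le_mul fun y hy => ?_
          have := hD'.card_nbrsIn_le hT (hB'sub hy)
          rw [← hO'] at this
          omega
        have h7 : Δ ≤ e * Δ := Nat.le_mul_of_pos_left _ (by omega)
        have h8 : (e + 1) * Δ = e * Δ + Δ := by ring
        omega
      · obtain ⟨e', rfl⟩ := Nat.exists_eq_add_of_le hge
        have h5 := ih O'.card (by omega) hD' (e := e') (by omega) hB'sub rfl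
        rw [← hO'] at h5
        have h6 : (μ + e') * Δ = μ * Δ + e' * Δ := by ring
        omega
  · push Not at hbig
    have hone : ∀ x ∈ G.bdry D, (G.nbrsIn x (G.outer D)).card ≤ 1 := fun x hx => by
      have := hbig x hx
      omega
    have hBl : G.links B (G.outer D) ≤ B.card * 1 := links_le_mul fun y hy => hone y (hB hy)
    obtain ⟨x, hx, hne⟩ := exists_bdry_nbrsIn_nonempty hG h.nonempty h0
    have hcb := card_bdry_insert hx
    have hco := card_outer_insert hx
    have hD' := h.insert_bdry hx
    have hcard1 : (G.nbrsIn x (G.outer D)).card = 1 :=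
      le_antisymm (hone x hx) (Finset.card_pos.2 hne)
    obtain ⟨r, hr⟩ := Finset.card_eq_one.1 hcard1
    have hsplit := links_split (G := G) (nbrsIn_subset (G := G) (x := x) (S := G.outer D))
    have hoi := outer_insert hx
    rw [hr] at hoi
    rw [hr, ← hoi, links_self_singleton, links_singleton_left] at hsplit
    have hxr : G.Adj x r := (mem_nbrsIn.1 (by rw [hr]; simp : r ∈ G.nbrsIn x (G.outer D))).2
    have hrb : r ∈ G.bdry (insert x D) := by
      rw [bdry_insert hx, hr]
      simp
    have hΔ1 : 1 ≤ Δ := le_trans ((degree_pos_iff_exists_adj G r).2 ⟨x, hxr.symm⟩) (hΔ r)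
    set O' := G.outer (insert x D) with hO'
    -- Absorbing `x` leaves the boundary size unchanged. If `r` then has two or more outer
    -- neighbors, `r` is absorbed too, which gains leaves.
    rcases Nat.lt_or_ge (G.nbrsIn r O').card 2 with hρ | hρ
    · have h5 := ih O'.card (by omega) hD' (e := e) (by omega) (B := {r})
        (Finset.singleton_subset_iff.2 hrb) rfl
      rw [← hO', links_singleton_left, Finset.card_singleton] at h5
      omega
    · have hle := hD'.card_nbrsIn_le hT hrb
      have hcb' := card_bdry_insert hrb
      have hco' := card_outer_insert hrb
      have hD'' := hD'.insert_bdry hrb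
      have hbi := bdry_insert hrb
      have hoi' := outer_insert hrb
      rw [← hO'] at hle hcb' hco' hoi' hbi
      set N := G.nbrsIn r O' with hN
      have hNO : N ⊆ O' := nbrsIn_subset
      have hsplit' := links_split (G := G) hNO
      rw [← hoi'] at hsplit'
      set O'' := G.outer (insert r (insert x D)) with hO''
      have hNO'' : Disjoint N O'' := by rw [hoi']; exact Finset.disjoint_sdiff
      have hρΔ : N.card ≤ Δ :=
        (Finset.card_le_card (nbrsIn_mono r (Finset.subset_univ _))).trans
          ((card_nbrsIn_univ r).trans_le (hΔ r))
      have hrN : G.links N {r} = N.card := by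
        rw [links_comm, links_singleton_left]
        congr 1
        exact Finset.filter_true_of_mem fun y hy => (mem_nbrsIn.1 hy).2
      have hrd : Disjoint {r} (N ∪ O'') := by
        rw [Finset.disjoint_singleton_left]
        intro hmem
        have : r ∈ O' := by
          rcases Finset.mem_union.1 hmem with hm | hm
          · exact hNO hm
          · rw [hoi'] at hm
            exact (Finset.mem_sdiff.1 hm).1
        rw [hoi] at this
        simp at this
      have hl := links_le_of_degree_le hΔ N ({r} ∪ (N ∪ O''))
      rw [links_union_right _ hrd, hrN, links_union_right _ hNO''] at hl
      have hNsub : N ⊆ G.bdry (insert r (insert x D)) := by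
        rw [hbi]
        exact Finset.subset_union_right
      obtain ⟨μ, hμ⟩ : ∃ μ, N.card = μ + 1 := ⟨N.card - 1, by omega⟩
      have hexp : (μ + 1) * Δ = μ * Δ + Δ := by ring
      have hμ1 : Δ ≤ μ * Δ := Nat.le_mul_of_pos_left _ (by omega)
      rw [hμ, hexp] at hl
      rcases Nat.lt_or_ge e μ with hlt | hge
      · obtain rfl : μ = e + 1 := by omega
        have h6 : G.links N O'' ≤ N.card * 1 := by
          refine links_le_mul fun y hy => ?_
          have := hD''.card_nbrsIn_le hT (hNsub hy)
          rw [← hO''] at this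
          omega
        have h5 := hD''.links_outer_le hG hT (by omega)
        rw [← hO''] at h5
        have h8 : (e + 1) * Δ = e * Δ + Δ := by ring
        rcases Nat.eq_zero_or_pos e with rfl | he0
        · have hNN := links_self_add_card_le (G := G) N
          rw [hμ] at hNN
          rcases h5 with h5 | h5
          · rw [h5, links_empty_right, links_empty_right] at hsplit'
            omega
          · omega
        · have h7 : Δ ≤ e * Δ := Nat.le_mul_of_pos_left _ he0
          have h9 : G.links O'' O'' ≤ 2 * O''.card := by
            rcases h5 with h5 | h5
            · rw [h5, links_empty_right]
              omega
            · omega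
          omega
      · obtain ⟨e', rfl⟩ := Nat.exists_eq_add_of_le hge
        have h5 := ih O''.card (by omega) hD'' (e := e') (by omega) hNsub rfl
        rw [← hO''] at h5
        have h6 : (μ + e') * Δ = μ * Δ + e' * Δ := by ring
        have h7 : max (2 * N.card) (N.card + Δ) = N.card + Δ := max_eq_right (by omega)
        omega

/-- If every vertex of `L = N(v)` has at most one neighbour outside `L ∪ {v}` and no connected set
has more than `|L|` neighbours, then `L` spans few edges. -/
theorem card_le_missing_add_one (hG : G.Connected) (hT : ∀ D, Grown G D → (G.bdry D).card ≤ T)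
    {v : V} (hv : (G.bdry {v}).card = T) (hR : 2 ≤ (G.outer {v}).card) (M : SimpleGraph V)
    (hM : ∀ x y, M.Adj x y ↔ x ∈ G.bdry {v} ∧ y ∈ G.bdry {v} ∧ x ≠ y ∧ ¬ G.Adj x y) :
    ((G.bdry {v}).filter fun x => (G.nbrsIn x (G.outer {v})).Nonempty).card
      ≤ M.edgeFinset.card + 1 := by
  set L := G.bdry {v} with hL
  set R := G.outer {v} with hRdef
  set L' := L.filter fun x => (G.nbrsIn x R).Nonempty with hL'
  have hLv : ∀ x ∈ L, G.Adj v x := by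
    intro x hx
    obtain ⟨-, d, hd, hadj⟩ := mem_bdry.1 hx
    rw [Finset.mem_singleton] at hd
    rwa [← hd]
  have hone : ∀ x ∈ L, (G.nbrsIn x R).card ≤ 1 := by
    intro x hx
    have := (Grown.single v).card_nbrsIn_le hT hx
    rw [← hRdef, ← hL] at this
    omega
  have huniq : ∀ x ∈ L, ∀ r ∈ R, ∀ r' ∈ R, G.Adj x r → G.Adj x r' → r = r' := by
    intro x hx r hr r' hr' h1 h2
    exact Finset.card_le_one.1 (hone x hx) r (mem_nbrsIn.2 ⟨hr, h1⟩) r' (mem_nbrsIn.2 ⟨hr', h2⟩)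
  have hLR : Disjoint L R := disjoint_bdry_outer _
  have hvL : v ∉ L := fun h => (mem_bdry.1 h).1 (Finset.mem_singleton_self v)
  have hvR : v ∉ R := fun h => (mem_outer.1 h).1 (Finset.mem_singleton_self v)
  -- Otherwise `x` and `z` are adjacent and have no common non-neighbor in `L`. The pair would then
  -- have `v`, `r`, `r'` and the rest of `L` as neighbors, one more than allowed.
  have hdiff : ∀ x ∈ L, ∀ z ∈ L, ∀ r ∈ R, ∀ r' ∈ R, G.Adj x r → G.Adj z r' → r ≠ r' →
      M.Reachable x z := by
    intro x hx z hz r hr r' hr' hxr hzr hrr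
    by_contra hreach
    have hxz : x ≠ z := fun h => hreach (h ▸ Reachable.refl _)
    have hadj : G.Adj x z := by
      by_contra hn
      exact hreach (Adj.reachable ((hM x z).2 ⟨hx, hz, hxz, hn⟩))
    have hgrown : Grown G {z, x} := (Grown.single x).step (Finset.mem_singleton_self x) hadj
    have hrL : r ∉ L := fun h => Finset.disjoint_left.1 hLR h hr
    have hrL' : r' ∉ L := fun h => Finset.disjoint_left.1 hLR h hr'
    have hsub : insert v (insert r (insert r' ((L.erase x).erase z))) ⊆ G.bdry {z, x} := by
      intro y hy
      rw [mem_bdry]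
      simp only [Finset.mem_insert, Finset.mem_erase, Finset.mem_singleton, not_or,
        exists_eq_or_imp, exists_eq_left] at hy ⊢
      rcases hy with rfl | rfl | rfl | ⟨h1, h2, h3⟩
      · exact ⟨⟨fun h => hvL (h ▸ hz), fun h => hvL (h ▸ hx)⟩, Or.inl (hLv z hz).symm⟩
      · exact ⟨⟨fun h => hrL (h ▸ hz), fun h => hrL (h ▸ hx)⟩, Or.inr hxr⟩
      · exact ⟨⟨fun h => hrL' (h ▸ hz), fun h => hrL' (h ▸ hx)⟩, Or.inl hzr⟩
      · refine ⟨⟨h1, h2⟩, ?_⟩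
        by_contra hcon
        rw [not_or] at hcon
        have e1 : M.Adj x y := (hM x y).2 ⟨hx, h3, h2.symm, hcon.2⟩
        have e2 : M.Adj z y := (hM z y).2 ⟨hz, h3, h1.symm, hcon.1⟩
        exact hreach (e1.reachable.trans e2.symm.reachable)
    have h1 := (Finset.card_le_card hsub).trans (hT _ hgrown)
    rw [Finset.card_insert_of_notMem, Finset.card_insert_of_notMem, Finset.card_insert_of_notMem,
      Finset.card_erase_of_mem (Finset.mem_erase.2 ⟨hxz.symm, hz⟩), Finset.card_erase_of_mem hx]
      at h1
    · have h2 : 2 ≤ L.card := Finset.one_lt_card.2 ⟨x, hx, z, hz, hxz⟩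
      omega
    · simp [hrL']
    · simp [hrL, hrr]
    · simp only [Finset.mem_insert, Finset.mem_erase, not_or, not_and]
      exact ⟨fun h => hvR (h ▸ hr), fun h => hvR (h ▸ hr'), fun _ _ => hvL⟩
  by_cases hsame : ∃ x ∈ L', ∃ z ∈ L', ∃ r ∈ R, ∃ r' ∈ R, G.Adj x r ∧ G.Adj z r' ∧ r ≠ r'
  · obtain ⟨x, hx, z, hz, r, hr, r', hr', hxr, hzr, hrr⟩ := hsame
    rw [hL', Finset.mem_filter] at hx hz
    refine card_reachable_le M x L' fun y hy => ?_
    rw [hL', Finset.mem_filter] at hy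
    obtain ⟨hyL, s, hs⟩ := hy
    rw [mem_nbrsIn] at hs
    by_cases hsr : r = s
    · exact (hdiff x hx.1 z hz.1 r hr r' hr' hxr hzr hrr).trans
        (hdiff y hyL z hz.1 s hs.1 r' hr' hs.2 hzr (hsr ▸ hrr)).symm
    · exact hdiff x hx.1 y hyL r hr s hs.1 hxr hs.2 hsr
  · push Not at hsame
    have hRne : R.Nonempty := Finset.card_pos.1 (by omega)
    obtain ⟨x0, hx0, hne⟩ := exists_bdry_nbrsIn_nonempty hG (Finset.singleton_nonempty v) hRne
    obtain ⟨r, hr⟩ := hne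
    rw [← hRdef, mem_nbrsIn] at hr
    rw [← hL] at hx0
    have hx0' : x0 ∈ L' := by
      rw [hL', Finset.mem_filter]
      exact ⟨hx0, r, mem_nbrsIn.2 hr⟩
    have hall : ∀ x ∈ L', G.Adj x r := by
      intro x hx
      obtain ⟨s, hs⟩ := (Finset.mem_filter.1 hx).2
      rw [mem_nbrsIn] at hs
      rw [hsame x0 hx0' x hx r hr.1 s hs.1 hr.2 hs.2]
      exact hs.2
    -- All of `L'` attaches to the single vertex `r`, so connectedness and a second vertex of `R`
    -- force an edge from `r` further out.
    obtain ⟨r2, hr2, hrr2⟩ : ∃ r2 ∈ R, G.Adj r r2 := by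
      have hgrown : Grown G (insert x0 {v}) := (Grown.single v).insert_bdry hx0
      have hb := bdry_insert hx0
      have ho := outer_insert hx0
      have hco := card_outer_insert hx0
      rw [← hRdef] at hb ho hco
      rw [← hL] at hb
      have hx01 := hone x0 hx0
      obtain ⟨y, hy, s, hs⟩ := exists_bdry_nbrsIn_nonempty hG hgrown.nonempty
        (Finset.card_pos.1 (by omega))
      rw [mem_nbrsIn, ho, Finset.mem_sdiff, mem_nbrsIn, not_and] at hs
      rw [hb, Finset.mem_union, Finset.mem_erase, mem_nbrsIn] at hy
      have hsr : s ≠ r := by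
        rintro rfl
        exact hs.1.2 hr.1 hr.2
      rcases hy with hy | hy
      · have hyL' : y ∈ L' := Finset.mem_filter.2 ⟨hy.2, s, mem_nbrsIn.2 ⟨hs.1.1, hs.2⟩⟩
        exact absurd (huniq y hy.2 s hs.1.1 r hr.1 hs.2 (hall y hyL')) hsr
      · obtain rfl := huniq x0 hx0 y hy.1 r hr.1 hy.2 hr.2
        exact ⟨s, hs.1.1, hs.2⟩
    -- Each vertex of `L'` misses some vertex of `L` outside `L'`; otherwise it and `r` would
    -- together have too many neighbors. The rank separates `L'` from the rest.
    refine (card_le_card_edgeFinset_of_rank M L' (fun x => if x ∈ L' then 1 else 0) ?_).trans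
      (Nat.le_succ _)
    intro x hx
    have hxL : x ∈ L := (Finset.mem_filter.1 hx).1
    by_contra hcon
    push Not at hcon
    have hxr := hall x hx
    have hgrown : Grown G {r, x} := (Grown.single x).step (Finset.mem_singleton_self x) hxr
    have hr2L : r2 ∉ L := fun h => Finset.disjoint_left.1 hLR h hr2
    have hrL : r ∉ L := fun h => Finset.disjoint_left.1 hLR h hr.1
    have hsub : insert v (insert r2 (L.erase x)) ⊆ G.bdry {r, x} := by
      intro y hy
      rw [mem_bdry]
      simp only [Finset.mem_insert, Finset.mem_erase, Finset.mem_singleton, not_or,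
        exists_eq_or_imp, exists_eq_left] at hy ⊢
      rcases hy with rfl | rfl | ⟨h2, h3⟩
      · exact ⟨⟨fun h => hvR (h ▸ hr.1), fun h => hvL (h ▸ hxL)⟩, Or.inr (hLv x hxL).symm⟩
      · exact ⟨⟨hrr2.ne', fun h => hr2L (h ▸ hxL)⟩, Or.inl hrr2⟩
      · refine ⟨⟨fun h => hrL (h ▸ h3), h2⟩, ?_⟩
        by_cases hy' : y ∈ L'
        · exact Or.inl (hall y hy').symm
        · right
          by_contra hn
          have := hcon y ((hM x y).2 ⟨hxL, h3, h2.symm, hn⟩)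
          simp [hx, hy'] at this
    have h1 := (Finset.card_le_card hsub).trans (hT _ hgrown)
    rw [Finset.card_insert_of_notMem, Finset.card_insert_of_notMem, Finset.card_erase_of_mem hxL]
      at h1
    · have h2 := Finset.card_pos.2 ⟨x, hxL⟩
      omega
    · simp [hr2L]
    · simp only [Finset.mem_insert, Finset.mem_erase, not_or, not_and]
      exact ⟨fun h => hvR (h ▸ hr2), fun _ => hvL⟩

/-- For each `x` in `L`, its neighbors, its non-neighbors and `x` itself are disjoint parts of `L`.
-/
theorem links_self_add_two_mul_missing (L : Finset V) (M : SimpleGraph V)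
    (hM : ∀ x y, M.Adj x y ↔ x ∈ L ∧ y ∈ L ∧ x ≠ y ∧ ¬ G.Adj x y) :
    G.links L L + 2 * M.edgeFinset.card + L.card ≤ L.card * L.card := by
  have h1 : 2 * M.edgeFinset.card = M.links L L := by
    have hout : ∀ x ∉ L, M.nbrsIn x Finset.univ = ∅ := by
      intro x hx
      ext y
      simp [nbrsIn, hM, hx]
    have hin : ∀ x, M.nbrsIn x Finset.univ = M.nbrsIn x L := by
      intro x
      ext y
      simp only [mem_nbrsIn, hM, Finset.mem_univ, true_and]
      tauto
    rw [← links_univ, links, ← Finset.sum_subset (Finset.subset_univ L)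
      (fun x _ hx => by rw [hout x hx, Finset.card_empty])]
    exact Finset.sum_congr rfl fun x _ => by rw [hin]
  have h2 : ∀ x ∈ L, (G.nbrsIn x L).card + (M.nbrsIn x L).card + 1 ≤ L.card := by
    intro x hx
    have hd : Disjoint (G.nbrsIn x L) (M.nbrsIn x L) := by
      rw [Finset.disjoint_left]
      intro y h1 h2
      exact ((hM x y).1 (mem_nbrsIn.1 h2).2).2.2.2 (mem_nbrsIn.1 h1).2
    rw [← Finset.card_union_of_disjoint hd,
      ← Finset.card_insert_of_notMem (a := x) (by simp [nbrsIn])]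
    exact Finset.card_le_card
      (Finset.insert_subset hx (Finset.union_subset nbrsIn_subset nbrsIn_subset))
  have h3 := Finset.sum_le_card_nsmul _ _ _ h2
  rw [Finset.sum_add_distrib, Finset.sum_add_distrib] at h3
  rw [h1]
  simpa [links] using h3

/-- The theorem of Ding, Johnson and Seymour: a connected graph in which every connected set has at
most `T` neighbours has few edges. -/
theorem two_mul_card_edgeFinset_le (hG : G.Connected)
    (hT : ∀ D, Grown G D → (G.bdry D).card ≤ T) (hn : T + 3 ≤ Fintype.card V) :
    2 * G.edgeFinset.card + T + 2 ≤ T * T + 2 * Fintype.card V := by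
  have := hG.nonempty
  obtain ⟨v, hv⟩ := G.exists_maximal_degree_vertex
  set Δ := G.maxDegree with hΔdef
  have hΔ : ∀ x, G.degree x ≤ Δ := G.degree_le_maxDegree
  have hgrown : Grown G {v} := Grown.single v
  have hL : G.bdry {v} = G.nbrsIn v Finset.univ := by
    ext y
    simp only [mem_bdry, mem_nbrsIn, Finset.mem_singleton, exists_eq_left, Finset.mem_univ,
      true_and, and_iff_right_iff_imp]
    exact fun h => h.ne'
  have hLc : (G.bdry {v}).card = Δ := by rw [hL, card_nbrsIn_univ, hv]
  have hcard := card_add_bdry_add_outer (G := G) {v}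
  have hTle := hT _ hgrown
  rw [Finset.card_singleton] at hcard
  have htot := links_univ (G := G)
  rw [← union_bdry_outer (G := G) {v},
    links_union_left _ (disjoint_bdry_union_outer {v}),
    links_union_right _ (disjoint_bdry_union_outer {v}),
    links_union_right _ (disjoint_bdry_union_outer {v}), links_self_singleton,
    links_comm (G.bdry {v} ∪ G.outer {v}) {v}, links_union_left _ (disjoint_bdry_outer _),
    links_union_right _ (disjoint_bdry_outer _), links_union_right _ (disjoint_bdry_outer _),
    links_union_right _ (disjoint_bdry_outer _), links_comm (G.outer {v}) (G.bdry {v})] at htot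
  have hvR : G.links {v} (G.outer {v}) = 0 := by
    rw [links_singleton_left, Finset.card_eq_zero]
    ext y
    simp only [mem_nbrsIn, mem_outer, Finset.notMem_empty, iff_false, not_and]
    intro h1 h2
    exact h1.2 v (Finset.mem_singleton_self v) h2
  have hvL : G.links {v} (G.bdry {v}) = Δ := by
    rw [links_singleton_left, ← hLc]
    congr 1
    rw [hL]
    exact Finset.filter_true_of_mem fun y hy => (mem_nbrsIn.1 hy).2
  rw [hvR, hvL] at htot
  set L := G.bdry {v} with hLdef
  set R := G.outer {v} with hRdef
  -- If Δ < T, the general estimate with e = T - Δ - 1 and the degree sum over `L` suffice. If Δ =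
  -- T, each edge from `L` to `R`, up to one, is offset by an edge missing in `L`.
  rcases Nat.lt_or_ge Δ T with hlt | hge
  · obtain ⟨e, rfl⟩ : ∃ e, T = Δ + e + 1 := ⟨T - Δ - 1, by omega⟩
    have h1 := hgrown.links_bdry_add_links_outer_le hG hT hΔ (e := e) (by rw [← hLdef]; omega)
      (B := L) (Finset.Subset.refl _)
    rw [← hRdef, hLc, max_eq_left (show Δ + Δ ≤ 2 * Δ by omega)] at h1
    have h2 := links_le_of_degree_le hΔ L ({v} ∪ (L ∪ R))
    rw [links_union_right _ (disjoint_bdry_union_outer {v}), links_comm L {v}, hvL,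
      links_union_right _ (disjoint_bdry_outer _), hLc] at h2
    nlinarith
  · obtain rfl : T = Δ := by omega
    have hone : ∀ x ∈ L, (G.nbrsIn x R).card ≤ 1 := by
      intro x hx
      have := hgrown.card_nbrsIn_le hT hx
      rw [← hRdef, ← hLdef] at this
      omega
    have hLR : G.links L R ≤ (L.filter fun x => (G.nbrsIn x R).Nonempty).card := by
      rw [links, Finset.card_filter]
      refine Finset.sum_le_sum fun x hx => ?_
      split_ifs with h0
      · exact hone x hx
      · rw [Finset.not_nonempty_iff_eq_empty] at h0
        rw [h0, Finset.card_empty]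
    set M : SimpleGraph V :=
      { Adj := fun x y => x ∈ L ∧ y ∈ L ∧ x ≠ y ∧ ¬ G.Adj x y
        symm := ⟨fun x y ⟨h1, h2, h3, h4⟩ => ⟨h2, h1, h3.symm, fun h => h4 h.symm⟩⟩
        loopless := ⟨fun x h => h.2.2.1 rfl⟩ } with hMdef
    have h1 := card_le_missing_add_one hG hT hLc (by rw [← hRdef]; omega) M (fun x y => Iff.rfl)
    rw [← hLdef, ← hRdef] at h1
    have h2 := links_self_add_two_mul_missing (G := G) L M (fun x y => Iff.rfl)
    have h3 := hgrown.links_outer_le hG hT hLc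
    rw [← hRdef] at h3
    rcases h3 with h3 | h3
    · rw [h3, Finset.card_empty] at hcard
      omega
    · rw [hLc] at h2
      omega

end Leaves

/-! ### Extremal graphs -/

section Examples

open scoped Classical

theorem card_edgeFinset_add_card_of_isCompl {V : Type*} [Fintype V] {H K : SimpleGraph V}
    (h : IsCompl H K) : H.edgeFinset.card + K.edgeFinset.card = (Fintype.card V).choose 2 := by
  have h1 : H.edgeFinset ∪ K.edgeFinset = (⊤ : SimpleGraph V).edgeFinset := by
    rw [← edgeFinset_sup, edgeFinset_inj]
    exact h.sup_eq_top
  rw [← card_edgeFinset_top_eq_card_choose_two, ← Finset.card_union_of_disjoint, h1]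
  rw [disjoint_edgeFinset]
  exact h.disjoint

theorem Connected.card_le_card_edgeFinset_add_one {V : Type*} [Fintype V] {G : SimpleGraph V}
    (hG : G.Connected) : Fintype.card V ≤ G.edgeFinset.card + 1 := by
  obtain ⟨v⟩ := hG.nonempty
  have := card_reachable_le G v Finset.univ (fun u _ => hG.preconnected v u)
  rwa [Finset.card_univ] at this

/-- Connected spanning subgraphs exist with every feasible number of edges. -/
theorem Connected.exists_le_card_eq {V : Type*} [Fintype V] {G : SimpleGraph V}
    (hG : G.Connected) {m : ℕ} (hm : Fintype.card V ≤ m + 1) (hmG : m ≤ G.edgeFinset.card) :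
    ∃ H ≤ G, H.Connected ∧ H.edgeFinset.card = m := by
  obtain ⟨T, hT, htree⟩ := hG.exists_isTree_le
  have hTc := htree.card_edgeFinset
  obtain ⟨S, hTS, hSG, hS⟩ := Finset.exists_subsuperset_card_eq (n := m)
    (edgeFinset_mono hT) (by omega) hmG
  have hSe : (fromEdgeSet (S : Set (Sym2 V))).edgeSet = S := by
    rw [edgeSet_fromEdgeSet]
    refine Set.Subset.antisymm Set.sdiff_subset fun e he => ⟨he, fun hd => ?_⟩
    exact G.not_isDiag_of_mem_edgeSet (mem_edgeFinset.1 (hSG he)) hd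
  have hSc : ∀ H : SimpleGraph V, H.edgeSet = S → H.edgeFinset.card = m := by
    intro H hH
    rw [← hS]
    congr 1
    ext e
    rw [mem_edgeFinset, hH]
    rfl
  refine ⟨fromEdgeSet S, ?_, htree.connected.mono ?_, ?_⟩
  · rw [← edgeSet_subset_edgeSet, hSe]
    exact fun e he => mem_edgeFinset.1 (hSG he)
  · rw [← edgeSet_subset_edgeSet, hSe]
    exact fun e he => hTS (mem_edgeFinset.2 he)
  · exact hSc _ hSe

/-- Deleting `q` edges that cover the first `2 q` vertices from the complete graph, and possibly
more edges. -/
theorem exists_connected_tmc_add_min_le {n q m : ℕ} (hq : q + 1 < n) (hm : n ≤ m + 1)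
    (hmq : m + q ≤ n.choose 2) : ∃ G : SimpleGraph (Fin n), G.Connected ∧
      G.edgeFinset.card = m ∧ G.tmc + min n (2 * q) ≤ m + n := by
  have : NeZero n := ⟨by omega⟩
  -- Reduction modulo n lets the last pair wrap around to vertex 0 when n is odd and all vertices
  -- are to be covered.
  set S : Finset (Sym2 (Fin n)) :=
    (Finset.range q).image fun i => s(Fin.ofNat n (2 * i), Fin.ofNat n (2 * i + 1)) with hS
  have hSc : S.card ≤ q := Finset.card_image_le.trans (Finset.card_range q).le
  obtain ⟨H, hH⟩ : ∃ H : SimpleGraph (Fin n), H = fromEdgeSet S := ⟨_, rfl⟩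
  have hHc : H.edgeFinset.card ≤ q := by
    refine le_trans (Finset.card_le_card ?_) hSc
    intro e he
    rw [mem_edgeFinset, hH, edgeSet_fromEdgeSet] at he
    exact he.1
  obtain ⟨K, hK⟩ : ∃ K, K = Hᶜ := ⟨_, rfl⟩
  have hcompl := card_edgeFinset_add_card_of_isCompl (hK ▸ isCompl_compl : IsCompl H K)
  rw [Fintype.card_fin] at hcompl
  -- A graph or its complement is connected, and `H` has fewer than n - 1 edges.
  have hconn : K.Connected := by
    rw [hK]
    rcases H.connected_or_connected_compl with h | h
    · have := h.card_le_card_edgeFinset_add_one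
      rw [Fintype.card_fin] at this
      omega
    · exact h
  obtain ⟨G, hGH, hG, hGm⟩ := hconn.exists_le_card_eq (m := m)
    (by rwa [Fintype.card_fin]) (by omega)
  refine ⟨G, hG, hGm, ?_⟩
  have hnon : ∀ v ∈ Finset.univ.filter (fun v : Fin n => v.1 < 2 * q),
      ∃ y, y ≠ v ∧ ¬ G.Adj v y := by
    intro v hv
    simp only [Finset.mem_filter, Finset.mem_univ, true_and] at hv
    have hne : ∀ i, Fin.ofNat n (2 * i) ≠ Fin.ofNat n (2 * i + 1) := by
      intro i h
      have h1 := congrArg Fin.val h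
      simp only [Fin.ofNat] at h1
      have h2 : (2 * i) ≡ (2 * i + 1) [MOD n] := h1
      have h3 := (Nat.modEq_iff_dvd' (Nat.le_succ _)).1 h2
      simp at h3
      omega
    have hadj : ∀ i < q, ¬ G.Adj (Fin.ofNat n (2 * i)) (Fin.ofNat n (2 * i + 1)) := by
      intro i hi hadj
      have h1 := hGH hadj
      rw [hK, compl_adj, hH, fromEdgeSet_adj] at h1
      exact h1.2 ⟨Finset.mem_image.2 ⟨i, Finset.mem_range.2 hi, rfl⟩, hne i⟩
    have hval : ∀ k, k = v.1 → Fin.ofNat n k = v := by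
      rintro k rfl
      exact Fin.ext (by simp [Fin.ofNat, Nat.mod_eq_of_lt v.2])
    rcases Nat.even_or_odd' v.1 with ⟨i, hi | hi⟩
    · refine ⟨Fin.ofNat n (2 * i + 1), ?_, ?_⟩
      · rw [← hval _ hi.symm]
        exact (hne i).symm
      · rw [← hval _ hi.symm]
        exact hadj i (by omega)
    · refine ⟨Fin.ofNat n (2 * i), ?_, ?_⟩
      · rw [← hval _ hi.symm]
        exact hne i
      · rw [← hval _ hi.symm]
        exact fun h => hadj i (by omega) h.symm
  have hcard : min n (2 * q) ≤ (Finset.univ.filter fun v : Fin n => v.1 < 2 * q).card := by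
    have : (Finset.range (min n (2 * q))).card
        ≤ (Finset.univ.filter fun v : Fin n => v.1 < 2 * q).card := by
      refine Finset.card_le_card_of_surjOn (fun i : Fin n => i.1) ?_
      intro k hk
      simp only [Finset.coe_range, Set.mem_Iio] at hk
      exact ⟨⟨k, by omega⟩, by simp; omega, rfl⟩
    rwa [Finset.card_range] at this
  have := tmc_add_card_le _ hnon
  rw [Fintype.card_fin] at this
  omega

theorem card_edgeFinset_eq_sum {n : ℕ} (G : SimpleGraph (Fin n)) :
    G.edgeFinset.card = ∑ j : Fin n, (Finset.univ.filter fun i => i < j ∧ G.Adj i j).card := by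
  rw [← Finset.card_sigma]
  symm
  refine Finset.card_bij (fun x _ => s(x.2, x.1)) ?_ ?_ ?_
  · rintro ⟨j, i⟩ h
    simp only [Finset.mem_sigma, Finset.mem_univ, Finset.mem_filter, true_and] at h
    simpa using h.2
  · rintro ⟨j, i⟩ h ⟨j', i'⟩ h' heq
    simp only [Finset.mem_sigma, Finset.mem_univ, Finset.mem_filter, true_and] at h h'
    rcases Sym2.eq_iff.1 heq with ⟨h1, h2⟩ | ⟨h1, h2⟩
    · simp only at h1 h2
      subst h1 h2
      rfl
    · simp only at h1 h2
      subst h1 h2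
      exact absurd h.1 (not_lt_of_gt h'.1)
  · intro e he
    induction e using Sym2.ind with
    | _ x y =>
      rw [mem_edgeFinset, mem_edgeSet] at he
      rcases lt_or_gt_of_ne he.ne with hlt | hlt
      · exact ⟨⟨y, x⟩, by simpa using ⟨hlt, he⟩, rfl⟩
      · exact ⟨⟨x, y⟩, by simpa using ⟨hlt, he.symm⟩, Sym2.eq_swap⟩

/-- A clique on `t` vertices, all but one of which are joined to the first vertex of a path. -/
def lollipop (n t : ℕ) : SimpleGraph (Fin n) :=
  fromRel fun i j => i.1 < j.1 ∧ (j.1 < t ∨ (j.1 = t ∧ 1 ≤ i.1) ∨ (t < j.1 ∧ i.1 + 1 = j.1))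

theorem lollipop_adj_of_lt {n t : ℕ} {i j : Fin n} (h : i.1 < j.1) : (lollipop n t).Adj i j ↔
    (j.1 < t ∨ (j.1 = t ∧ 1 ≤ i.1) ∨ (t < j.1 ∧ i.1 + 1 = j.1)) := by
  rw [lollipop, fromRel_adj]
  constructor
  · rintro ⟨-, h1 | h1⟩
    · exact h1.2
    · omega
  · intro h1
    exact ⟨fun he => by rw [he] at h; omega, Or.inl ⟨h, h1⟩⟩

theorem card_edgeFinset_lollipop {n t : ℕ} (ht : 1 ≤ t) (htn : t < n) :
    (lollipop n t).edgeFinset.card + 2 = t.choose 2 + n := by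
  rw [card_edgeFinset_eq_sum]
  have hterm : ∀ j : Fin n, (Finset.univ.filter fun i => i < j ∧ (lollipop n t).Adj i j).card
      = if j.1 < t then j.1 else if j.1 = t then t - 1 else 1 := by
    intro j
    have h1 : ((Finset.univ.filter fun i => i < j ∧ (lollipop n t).Adj i j).map
        Fin.valEmbedding) = if j.1 < t then Finset.range j.1 else
          if j.1 = t then Finset.Ico 1 t else {j.1 - 1} := by
      ext k
      simp only [Finset.mem_map, Finset.mem_filter, Finset.mem_univ, true_and,
        Fin.valEmbedding_apply]
      have hj := j.2
      have hk : (∃ a : Fin n, (a < j ∧ (lollipop n t).Adj a j) ∧ a.1 = k) ↔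
          k < j.1 ∧ (j.1 < t ∨ (j.1 = t ∧ 1 ≤ k) ∨ (t < j.1 ∧ k + 1 = j.1)) := by
        constructor
        · rintro ⟨a, ⟨h1, h2⟩, rfl⟩
          exact ⟨h1, (lollipop_adj_of_lt h1).1 h2⟩
        · rintro ⟨h1, h2⟩
          exact ⟨⟨k, by omega⟩, ⟨h1, (lollipop_adj_of_lt (by exact h1)).2 h2⟩, rfl⟩
      rw [hk]
      split_ifs with h2 h3
      · rw [Finset.mem_range]
        omega
      · rw [Finset.mem_Ico]
        omega
      · rw [Finset.mem_singleton]
        omega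
    rw [← Finset.card_map Fin.valEmbedding, h1]
    split_ifs <;> simp
  rw [Finset.sum_congr rfl fun j _ => hterm j,
    Fin.sum_univ_eq_sum_range (fun j => if j < t then j else if j = t then t - 1 else 1) n]
  obtain ⟨d, rfl⟩ : ∃ d, n = t + 1 + d := ⟨n - t - 1, by omega⟩
  rw [Finset.sum_range_add, Finset.sum_range_succ]
  have h1 : ∑ j ∈ Finset.range t, (if j < t then j else if j = t then t - 1 else 1)
      = t.choose 2 := by
    rw [Nat.choose_two_right, ← Finset.sum_range_id]
    refine Finset.sum_congr rfl fun j hj => ?_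
    rw [if_pos (Finset.mem_range.1 hj)]
  have h2 : ∑ x ∈ Finset.range d, (if t + 1 + x < t then t + 1 + x else
      if t + 1 + x = t then t - 1 else 1) = d := by
    rw [Finset.sum_congr rfl (g := fun _ => 1)]
    · simp
    · intro x _
      rw [if_neg (by omega), if_neg (by omega)]
  rw [h1, h2]
  simp only [lt_irrefl, if_false, if_true]
  omega

theorem lollipop_connected {n t : ℕ} (ht : 2 ≤ t) (htn : t < n) : (lollipop n t).Connected := by
  have h : ∀ k, ∀ hk : k < n, (lollipop n t).Reachable ⟨1, by omega⟩ ⟨k, hk⟩ := by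
    intro k
    induction k using Nat.strong_induction_on with
    | _ k ih =>
      intro hk
      rcases Nat.lt_trichotomy k 1 with h1 | rfl | h1
      · exact (Adj.reachable ((lollipop_adj_of_lt (by exact h1)).2 (Or.inl (by exact ht)))).symm
      · exact Reachable.refl _
      · by_cases h2 : k ≤ t
        · refine Adj.reachable ((lollipop_adj_of_lt (by exact h1)).2 ?_)
          simp only
          omega
        · refine (ih (k - 1) (by omega) (by omega)).trans
            (Adj.reachable ((lollipop_adj_of_lt (by simp only; omega)).2 ?_))
          simp only
          omega
  have : Nonempty (Fin n) := ⟨⟨1, by omega⟩⟩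
  exact ⟨fun u v => (h u.1 u.2).symm.trans (h v.1 v.2)⟩

theorem exists_connected_tmc_add_le_of_pendant {n t m : ℕ} (ht : 2 ≤ t) (htn : t + 2 ≤ n)
    (hm : n ≤ m + 1) (hmt : m + 2 ≤ t.choose 2 + n) : ∃ G : SimpleGraph (Fin n), G.Connected ∧
      G.edgeFinset.card = m ∧ G.tmc + n ≤ m + t + 2 := by
  have hcard := card_edgeFinset_lollipop (n := n) (t := t) (by omega) (by omega)
  obtain ⟨G, hGle, hG, hGm⟩ := (lollipop_connected ht (show t < n by omega)).exists_le_card_eq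
    (m := m) (by rwa [Fintype.card_fin]) (by omega)
  refine ⟨G, hG, hGm, ?_⟩
  rw [← hGm]
  refine tmc_add_le_of_pendant_path (by omega) htn (by omega) ?_
    ⟨⟨0, by omega⟩, ⟨t, by omega⟩, by simp only; omega, rfl, ?_⟩
  · intro i j hij htj hadj
    have := (lollipop_adj_of_lt hij).1 (hGle hadj)
    omega
  · intro hadj
    have := (lollipop_adj_of_lt (by simp only; omega)).1 (hGle hadj)
    simp only at this
    omega

/-- The edge from the end of the tail back to vertex 0, the clique vertex not adjacent to `t`, adds
one edge to the lollipop and keeps the bound. -/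
theorem exists_connected_tmc_add_le_of_theta {n t : ℕ} (ht : 2 ≤ t) (htn : t + 3 ≤ n) :
    ∃ G : SimpleGraph (Fin n), G.Connected ∧
      G.edgeFinset.card + 1 = t.choose 2 + n ∧ G.tmc + n ≤ G.edgeFinset.card + t + 2 := by
  have hcard := card_edgeFinset_lollipop (n := n) (t := t) (by omega) (by omega)
  set a : Fin n := ⟨0, by omega⟩ with ha
  set b : Fin n := ⟨n - 1, by omega⟩ with hb
  have hab : a ≠ b := by
    rw [Ne, Fin.ext_iff]
    simp only [ha, hb]
    omega
  have hnab : ¬ (lollipop n t).Adj a b := by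
    rw [lollipop_adj_of_lt (by simp only [ha, hb]; omega)]
    simp only [ha, hb]
    omega
  obtain ⟨K, hK⟩ : ∃ K, K = lollipop n t ⊔ edge a b := ⟨_, rfl⟩
  have hcard' : K.edgeFinset.card + 1 = t.choose 2 + n := by
    have h := card_edgeFinset_sup_edge _ hnab hab
    have h' : K.edgeFinset.card = (lollipop n t).edgeFinset.card + 1 := by
      subst hK
      convert h
    omega
  refine ⟨K, (lollipop_connected ht (show t < n by omega)).mono (hK ▸ le_sup_left), hcard', ?_⟩
  have hadj : ∀ i j : Fin n, i.1 < j.1 → (K.Adj i j ↔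
      (j.1 < t ∨ (j.1 = t ∧ 1 ≤ i.1) ∨ (t < j.1 ∧ i.1 + 1 = j.1)) ∨
        (i.1 = 0 ∧ j.1 = n - 1)) := by
    intro i j hij
    rw [hK, sup_adj, lollipop_adj_of_lt hij, edge_adj]
    simp only [Fin.ext_iff, ha, hb, Ne]
    omega
  have htheta : IsTheta K (n - t)
      (fun x => if h : t + x < n then ⟨t + x, h⟩ else a)
      (Finset.univ.filter fun v : Fin n => 1 ≤ v.1 ∧ v.1 < t) := by
    refine ⟨by omega, ⟨⟨1, by omega⟩, by simp; omega⟩, ?_, ?_, ?_, ?_, ?_, ?_⟩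
    · intro x hx y hy hxy
      split_ifs at hxy with h1 h2 h2
      · have := Fin.ext_iff.1 hxy
        simp only at this
        omega
      · have := Fin.ext_iff.1 hxy
        simp only [ha] at this
        omega
      · have := Fin.ext_iff.1 hxy
        simp only [ha] at this
        omega
      · omega
    · intro x hx
      simp only [Finset.mem_filter, Finset.mem_univ, true_and]
      split_ifs with h1
      · simp only
        omega
      · simp only [ha]
        omega
    · intro v
      by_cases h1 : 1 ≤ v.1 ∧ v.1 < t
      · exact Or.inl (by simpa using h1)
      · right
        by_cases h2 : v.1 = 0
        · refine ⟨n - t, le_rfl, ?_⟩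
          rw [dif_neg (by omega)]
          exact Fin.ext h2
        · refine ⟨v.1 - t, by have := v.2; omega, ?_⟩
          rw [dif_pos (by have := v.2; omega)]
          exact Fin.ext (by simp only; omega)
    · intro x hx
      rw [dif_pos (by omega)]
      split_ifs with h1
      · rw [hadj _ _ (by simp only; omega)]
        simp only
        omega
      · refine ((hadj a ⟨t + x, by omega⟩ (by simp only [ha]; omega)).2 (Or.inr ⟨rfl, ?_⟩)).symm
        simp only
        omega
    · intro x hx0 hx y hxy
      rw [dif_pos (by omega)] at hxy
      rw [dif_pos (show t + (x - 1) < n by omega)]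
      have hy := y.2
      rcases Nat.lt_trichotomy y.1 (t + x) with h1 | h1 | h1
      · have := (hadj _ _ (by exact h1)).1 hxy.symm
        simp only at this
        by_cases h2 : y.1 + 1 = t + x
        · left
          exact Fin.ext (by simp only; omega)
        · right
          rw [dif_neg (by omega)]
          exact Fin.ext (by simp only [ha]; omega)
      · exact absurd hxy (by
          rw [show (⟨t + x, by omega⟩ : Fin n) = y from Fin.ext h1.symm]
          exact K.loopless.irrefl y)
      · have := (hadj _ _ (by exact h1)).1 hxy
        simp only at this
        right
        rw [dif_pos (by omega)]
        exact Fin.ext (by simp only; omega)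
    · intro h
      rw [dif_pos (by omega), dif_neg (by omega)] at h
      have := (hadj _ _ (by simp only [ha]; omega)).1 h.symm
      simp only [ha] at this
      omega
  have := htheta.tmc_add_le
  omega

end Examples

/-! ### Matching bounds in each range of k -/

section Bounds

open scoped Classical

theorem ncard_edgeSet {V : Type*} [Fintype V] (G : SimpleGraph V) :
    G.edgeSet.ncard = G.edgeFinset.card := by
  rw [← coe_edgeFinset, Set.ncard_coe_finset]

theorem two_mul_choose_two_add (n : ℕ) : 2 * n.choose 2 + n = n * n := by
  rw [Nat.choose_two_right, Nat.mul_div_cancel' (Nat.even_mul_pred_self n).two_dvd]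
  cases n with
  | zero => rfl
  | succ n => rw [Nat.add_sub_cancel]; ring

/-- The lower bound on `tmc` from a spanning tree with more than `T` leaves. -/
theorem Connected.card_add_le_tmc_add {V : Type*} [Fintype V] {G : SimpleGraph V}
    (hG : G.Connected) {T : ℕ} (hn : T + 3 ≤ Fintype.card V)
    (hm : Fintype.card V + T.choose 2 ≤ G.edgeFinset.card) :
    G.edgeFinset.card + T + 3 ≤ G.tmc + Fintype.card V := by
  by_cases h : ∃ D, Grown G D ∧ T < (G.bdry D).card
  · obtain ⟨D, hD, hlt⟩ := h
    have := hD.le_tmc hG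
    omega
  · push Not at h
    have h1 := two_mul_card_edgeFinset_le hG h hn
    have h2 := two_mul_choose_two_add T
    omega

/-- The degree sum yields a vertex of degree at least two, and the bound from a connected set
applies to it alone. -/
theorem Connected.three_le_tmc {V : Type*} [Fintype V] {G : SimpleGraph V}
    (hG : G.Connected) (hn : 3 ≤ Fintype.card V) : 3 ≤ G.tmc := by
  have hm := hG.card_le_card_edgeFinset_add_one
  obtain ⟨v, hv⟩ : ∃ v, 2 ≤ G.degree v := by
    by_contra! h
    have h1 := G.sum_degrees_eq_twice_card_edges
    have h2 : ∑ v, G.degree v ≤ ∑ _v : V, 1 :=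
      Finset.sum_le_sum fun v _ => Nat.le_of_lt_succ (h v)
    simp only [Finset.sum_const, Finset.card_univ, smul_eq_mul, mul_one] at h2
    omega
  have h1 := (Grown.single (G := G) v).le_tmc hG
  have h2 : G.degree v ≤ (G.bdry {v}).card := by
    rw [← card_nbrsIn_univ]
    refine Finset.card_le_card fun y hy => ?_
    have hadj := (mem_nbrsIn.1 hy).2
    rw [mem_bdry]
    simpa using ⟨hadj.ne', hadj⟩
  omega

/-- Graphs missing fewer than half as many edges as they have vertices. -/
theorem card_add_card_le_tmc_add {V : Type*} [Fintype V] {G : SimpleGraph V} {r : ℕ}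
    (hr : 2 * r < Fintype.card V) (hm : (Fintype.card V).choose 2 ≤ G.edgeFinset.card + r) :
    G.edgeFinset.card + Fintype.card V ≤ G.tmc + 2 * r := by
  obtain ⟨H, hH⟩ : ∃ H, H = Gᶜ := ⟨_, rfl⟩
  have hcompl := card_edgeFinset_add_card_of_isCompl (hH ▸ isCompl_compl : IsCompl G H)
  set X := Finset.univ.filter fun v => 0 < H.degree v with hX
  have hXc : X.card ≤ 2 * r := by
    have h1 : X.card ≤ ∑ v, H.degree v := by
      rw [hX, Finset.card_filter]
      refine Finset.sum_le_sum fun v _ => ?_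
      split_ifs <;> omega
    rw [sum_degrees_eq_twice_card_edges] at h1
    omega
  have hXmem : ∀ u v, u ≠ v → ¬ G.Adj u v → u ∈ X := by
    intro u v huv hn
    rw [hX, Finset.mem_filter, degree_pos_iff_exists_adj]
    exact ⟨Finset.mem_univ _, v, by rw [hH, compl_adj]; exact ⟨huv, hn⟩⟩
  obtain ⟨w, hw⟩ : ∃ w, w ∉ X := by
    by_contra! h
    have := Finset.card_le_card (fun v _ => h v : Finset.univ ⊆ X)
    rw [Finset.card_univ] at this
    omega
  have h1 := (Grown.single (G := G) w).card_le_tmc_add (X := X)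
    (fun x hx => ⟨w, Finset.mem_singleton_self w, by
      by_contra hn
      exact hw (hXmem w x (fun h => hw (h ▸ hx)) hn)⟩)
    (fun u v huv hn => ⟨Or.inr (hXmem u v huv hn),
      Or.inr (hXmem v u huv.symm fun h => hn h.symm)⟩)
  rw [Finset.card_singleton] at h1
  omega

theorem isLeast_forcingBounds {n k f : ℕ} (hn : n ≤ f + 1)
    (hforce : ∀ G : SimpleGraph (Fin n), G.Connected → f ≤ G.edgeFinset.card → k ≤ G.tmc)
    (hlow : f + 1 = n ∨ ∃ G : SimpleGraph (Fin n), G.Connected ∧ G.edgeFinset.card + 1 = f ∧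
      G.tmc < k) : IsLeast (forcingBounds n k) f := by
  refine ⟨⟨hn, fun G hG hm => hforce G hG (by rwa [← ncard_edgeSet])⟩, ?_⟩
  rintro m ⟨hm, hf⟩
  rcases hlow with h | ⟨G, hG, hGf, hlt⟩
  · omega
  · by_contra hmf
    have := hf G hG (by rw [ncard_edgeSet]; omega)
    omega

theorem isLeast_forcingBounds_three {n f : ℕ} (hn : 2 ≤ n) (hf : f + 1 = n) :
    IsLeast (forcingBounds n 3) f := by
  refine isLeast_forcingBounds hf.ge ?_ (Or.inl hf)
  intro G hG _
  rcases Nat.lt_or_ge n 3 with h3 | h3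
  · obtain rfl : n = 2 := by omega
    have hm := hG.card_le_card_edgeFinset_add_one
    have := card_add_card_le_tmc_add (G := G) (r := 0) (by simp) (by simpa using hm)
    rw [Fintype.card_fin] at this hm
    omega
  · exact hG.three_le_tmc (by rwa [Fintype.card_fin])

theorem choose_two_succ (n : ℕ) : (n + 1).choose 2 = n.choose 2 + n := by
  rw [Nat.choose_succ_succ' n 1, Nat.choose_one_right, add_comm]

/-- Forcing uses T = t - 1. With f - 1 edges, the lollipop and its connected subgraphs serve for s >
0, while s = 0 needs one edge more than a lollipop has. -/
theorem isLeast_forcingBounds_sparse {n k f t s : ℕ} (ht : 2 ≤ t) (htn : t + 2 ≤ n)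
    (hs : s + 1 ≤ t) (hk : k + s = t.choose 2 + t + 2) (hf : f + t + 2 = n + k) :
    IsLeast (forcingBounds n k) f := by
  obtain ⟨T, rfl⟩ : ∃ T, t = T + 1 := ⟨t - 1, by omega⟩
  have hT := choose_two_succ T
  refine isLeast_forcingBounds (by omega) ?_ (Or.inr ?_)
  · intro G hG hm
    have := hG.card_add_le_tmc_add (T := T) (by rw [Fintype.card_fin]; omega)
      (by rw [Fintype.card_fin]; omega)
    rw [Fintype.card_fin] at this
    omega
  · rcases Nat.eq_zero_or_pos s with rfl | hs0
    -- For n = t + 2 the theta path would have length two, which is too short. Missing edges that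
    -- cover all vertices take its place.
    · rcases Nat.lt_or_ge n (T + 1 + 3) with hlt | hge
      · obtain rfl : n = T + 3 := by omega
        have h1 : (T + 2).choose 2 = (T + 1).choose 2 + (T + 1) := choose_two_succ _
        have h2 : (T + 3).choose 2 = (T + 2).choose 2 + (T + 2) := choose_two_succ _
        obtain ⟨G, hG, hGm, hlt⟩ := exists_connected_tmc_add_min_le (n := T + 3)
          (q := (T + 4) / 2) (m := f - 1) (by omega) (by omega) (by omega)
        rw [min_eq_left (by omega)] at hlt
        exact ⟨G, hG, by omega, by omega⟩
      · obtain ⟨G, hG, hGm, hlt⟩ := exists_connected_tmc_add_le_of_theta ht hge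
        exact ⟨G, hG, by omega, by omega⟩
    · obtain ⟨G, hG, hGm, hlt⟩ := exists_connected_tmc_add_le_of_pendant (m := f - 1) ht htn
        (by omega) (by omega)
      exact ⟨G, hG, by omega, by omega⟩

/-- With T = n - 3 the spanning tree bound reads tmc ≥ m. It is attained when the missing edges
cover every vertex, for which half of n, rounded up, are enough. -/
theorem isLeast_forcingBounds_middle {n k : ℕ} (hk1 : n.choose 2 + 4 ≤ k + n)
    (hk2 : k + 3 * (n / 2) ≤ n.choose 2 + n)
    (hodd : ¬ (Odd n ∧ k + 3 * (n / 2) = n.choose 2 + n)) : IsLeast (forcingBounds n k) k := by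
  obtain ⟨T, rfl⟩ : ∃ T, n = T + 3 := ⟨n - 3, by omega⟩
  have h1 := choose_two_succ T
  have h2 : (T + 2).choose 2 = (T + 1).choose 2 + (T + 1) := choose_two_succ _
  have h3 : (T + 3).choose 2 = (T + 2).choose 2 + (T + 2) := choose_two_succ _
  rw [Nat.odd_iff] at hodd
  refine isLeast_forcingBounds (by omega) ?_ (Or.inr ?_)
  · intro G hG hm
    have := hG.card_add_le_tmc_add (T := T) (by rw [Fintype.card_fin])
      (by rw [Fintype.card_fin]; omega)
    rw [Fintype.card_fin] at this
    omega
  · obtain ⟨G, hG, hGm, hlt⟩ := exists_connected_tmc_add_min_le (n := T + 3)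
      (q := (T + 4) / 2) (m := k - 1) (by omega) (by omega) (by omega)
    rw [min_eq_left (by omega)] at hlt
    exact ⟨G, hG, by omega, by omega⟩

theorem isLeast_forcingBounds_dense {n k f r : ℕ} (hn : 2 ≤ n)
    (hr : (r + 1 ≤ n / 2 ∧ n.choose 2 + n < k + 3 * (r + 1) ∧ k + 3 * r ≤ n.choose 2 + n) ∨
      (Odd n ∧ r = n / 2 ∧ k + 3 * (n / 2) = n.choose 2 + n))
    (hf : f + r = n.choose 2) : IsLeast (forcingBounds n k) f := by
  rw [Nat.odd_iff] at hr
  have hforce : ∀ G : SimpleGraph (Fin n), G.Connected → f ≤ G.edgeFinset.card → k ≤ G.tmc := by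
    intro G _ hm
    have := card_add_card_le_tmc_add (G := G) (r := r) (by rw [Fintype.card_fin]; omega)
      (by rw [Fintype.card_fin]; omega)
    rw [Fintype.card_fin] at this
    omega
  -- For n < 4 the value f may equal n - 1, so that no connected graph has f - 1 edges.
  rcases Nat.lt_or_ge n 4 with h4 | h4
  · have hcases : n = 2 ∨ n = 3 := by omega
    rcases hcases with rfl | rfl
    · have hc : Nat.choose 2 2 = 1 := rfl
      exact isLeast_forcingBounds (by omega) hforce (Or.inl (by omega))
    · have hc : Nat.choose 3 2 = 3 := rfl
      refine isLeast_forcingBounds (by omega) hforce ?_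
      rcases hr with hr | hr
      · right
        obtain ⟨G, hG, hGm, hlt⟩ := exists_connected_tmc_add_min_le (n := 3)
          (q := 1) (m := 2) (by omega) (by omega) (by omega)
        rw [min_eq_right (by omega)] at hlt
        exact ⟨G, hG, by omega, by omega⟩
      · left
        omega
  · have hC := two_mul_choose_two_add n
    have hnn : 4 * n ≤ n * n := Nat.mul_le_mul_right n h4
    refine isLeast_forcingBounds (by omega) hforce (Or.inr ?_)
    obtain ⟨G, hG, hGm, hlt⟩ := exists_connected_tmc_add_min_le (n := n)
      (q := r + 1) (m := f - 1) (by omega) (by omega) (by omega)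
    refine ⟨G, hG, by omega, ?_⟩
    rcases hr with hr | hr
    · rw [min_eq_right (by omega)] at hlt
      omega
    · rw [min_eq_left (by omega)] at hlt
      omega

theorem exists_sparse_parameters {n k : ℕ} (hk : 4 ≤ k) (hkn : k + n ≤ n.choose 2 + 3)
    (hn : 2 ≤ n) : ∃ t s : ℕ, 2 ≤ t ∧ t + 2 ≤ n ∧ s + 1 ≤ t ∧ k + s = t.choose 2 + t + 2 := by
  obtain ⟨N, rfl⟩ : ∃ N, n = N + 2 := ⟨n - 2, by omega⟩
  have h1 := choose_two_succ N
  have h2 : (N + 2).choose 2 = (N + 1).choose 2 + (N + 1) := choose_two_succ _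
  -- The least such t is taken. The bound grows by exactly t from t - 1 to t, whence s ≤ t - 1.
  have hex : ∃ t, k ≤ t.choose 2 + t + 2 := ⟨N, by omega⟩
  have hspec := Nat.find_spec hex
  have hle : Nat.find hex ≤ N := Nat.find_min' hex (by omega)
  obtain ⟨t, ht⟩ : ∃ t, t = Nat.find hex := ⟨_, rfl⟩
  rw [← ht] at hspec hle
  have ht2 : 2 ≤ t := by
    by_contra hlt
    have : t = 0 ∨ t = 1 := by omega
    rcases this with rfl | rfl
    · simp at hspec
      omega
    · simp at hspec
      omega
  have hmin := Nat.find_min hex (m := t - 1) (by omega)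
  obtain ⟨u, rfl⟩ : ∃ u, t = u + 1 := ⟨t - 1, by omega⟩
  rw [Nat.add_sub_cancel] at hmin
  have h3 := choose_two_succ u
  exact ⟨u + 1, (u + 1).choose 2 + (u + 1) + 2 - k, ht2, by omega, by omega, by omega⟩

end Bounds

end SimpleGraph

/-! ### The main theorem -/

open SimpleGraph in
theorem theorem3 (n k : ℕ) (hk : 3 ≤ k) (hkn : k ≤ n.choose 2 + n) (f : ℕ) :
    IsLeast (SimpleGraph.forcingBounds n k) f ↔
      (k = 3 ∧ f + 1 = n) ∨
      (∃ t s : ℕ, 2 ≤ t ∧ t + 2 ≤ n ∧ s + 1 ≤ t ∧ k + s = t.choose 2 + t + 2 ∧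
        f + t + 2 = n + k) ∨
      (n.choose 2 + 4 ≤ k + n ∧ k + 3 * (n / 2) ≤ n.choose 2 + n ∧
        ¬ (Odd n ∧ k + 3 * (n / 2) = n.choose 2 + n) ∧ f = k) ∨
      (∃ r : ℕ,
        ((r + 1 ≤ n / 2 ∧ n.choose 2 + n < k + 3 * (r + 1) ∧ k + 3 * r ≤ n.choose 2 + n) ∨
          (Odd n ∧ r = n / 2 ∧ k + 3 * (n / 2) = n.choose 2 + n)) ∧
        f + r = n.choose 2) := by
  have hC := two_mul_choose_two_add n
  have hn : 2 ≤ n := by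
    by_contra hlt
    have : n = 0 ∨ n = 1 := by omega
    rcases this with rfl | rfl
    · simp at hkn
      omega
    · simp at hkn
      omega
  constructor
  · intro hf
    -- The ranges exhaust all k, and a least element is unique, so f is the value already found in
    -- the range of k.
    by_cases hk3 : k = 3
    · subst hk3
      refine Or.inl ⟨rfl, ?_⟩
      rw [hf.unique (isLeast_forcingBounds_three (f := n - 1) hn (by omega))]
      omega
    right
    rcases Nat.lt_or_ge (k + n) (n.choose 2 + 4) with h1 | h1
    · left
      obtain ⟨t, s, ht, htn, hs, hks⟩ := exists_sparse_parameters (n := n) (k := k) (by omega)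
        (by omega) hn
      refine ⟨t, s, ht, htn, hs, hks, ?_⟩
      rw [hf.unique (isLeast_forcingBounds_sparse (f := n + k - t - 2) ht htn hs hks (by omega))]
      omega
    right
    have hnn : 2 * n ≤ n * n := Nat.mul_le_mul_right n hn
    rcases Nat.lt_or_ge (n.choose 2 + n) (k + 3 * (n / 2)) with h2 | h2
    · right
      have hr : ((n.choose 2 + n - k) / 3 + 1 ≤ n / 2 ∧
          n.choose 2 + n < k + 3 * ((n.choose 2 + n - k) / 3 + 1) ∧
          k + 3 * ((n.choose 2 + n - k) / 3) ≤ n.choose 2 + n) := by omega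
      refine ⟨(n.choose 2 + n - k) / 3, Or.inl hr, ?_⟩
      rw [hf.unique (isLeast_forcingBounds_dense (f := n.choose 2 - (n.choose 2 + n - k) / 3) hn
        (Or.inl hr) (by omega))]
      omega
    · by_cases hodd : Odd n ∧ k + 3 * (n / 2) = n.choose 2 + n
      · right
        refine ⟨n / 2, Or.inr ⟨hodd.1, rfl, hodd.2⟩, ?_⟩
        rw [hf.unique (isLeast_forcingBounds_dense (f := n.choose 2 - n / 2) hn
          (Or.inr ⟨hodd.1, rfl, hodd.2⟩) (by omega))]
        omega
      · left
        exact ⟨h1, h2, hodd, hf.unique (isLeast_forcingBounds_middle h1 h2 hodd)⟩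
  · rintro (⟨rfl, hf⟩ | ⟨t, s, ht, htn, hs, hks, hf⟩ | ⟨h1, h2, h3, rfl⟩ | ⟨r, hr, hf⟩)
    · exact isLeast_forcingBounds_three hn hf
    · exact isLeast_forcingBounds_sparse ht htn hs hks hf
    · exact isLeast_forcingBounds_middle h1 h2 h3
    · exact isLeast_forcingBounds_dense hn hr hf
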